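/- All sets are sets of natural numbers. A computable approximation of a set $A$ is a uniformly computable sequence of sets $\langle A_s\rangle_{s<\omega}$ such that for every $x$, $A_s(x)=A(x)$ for all but finitely many $s$. A *cost function* is a non-increasing function $c:\omega\to[0,\infty)$ with $\lim_x c(x)=0$ which has a *monotone approximation*, that is, a uniformly computable sequence $\langle c_s\rangle_{s<\omega}$ of functions from $\omega$ to the non-negative rationals such that each $c_s$ is non-increasing and, for each $x$, the sequence $\langle c_s(x)\rangle_{s}$ is non-decreasing and converges to $c(x)$. A $\Delta^0_2$ set $A$ *obeys* $c$ if there are a computable approximation $\langle A_s\rangle$ of $A$ and a monotone approximation $\langle c_s\rangle$ of $c$ such that $\sum_s c_s(x_s)<\infty$, where $x_s$ is the least $x$ with $A_{s-1}(x)\neq A_s(x)$ and the sum is over those $s\ge 1$ for which $A_{s-1}\ne A_s$. For a monotone approximation $\langle c_s\rangle$ and a rational $\epsilon>0$ let $m_1(\epsilon)=0$, and let $m_{k+1}(\epsilon)$ be the least $s>m_k(\epsilon)$ with $c_s(m_k(\epsilon))\ge\epsilon$ (undefined if there is none). The cost function $c$ is *benign* if it has a monotone approximation for which the last $k$ such that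 $m_k(\epsilon)$ is defined is bounded by a computable function of $\epsilon$. The *change set* of an approximation $\langle B_s\rangle$ is the set of (codes of) pairs $(x,n)$ such that $B_{s+1}(x)\ne B_s(x)$ for at least $n$ many $s$. **Theorem.** There is a benign cost function $c$ such that for every $\Delta^0_2$ set $A$ which obeys $c$, there is a computably enumerable set $W$ which computes $A$ and which obeys every cost function that $A$ obeys. Moreover, $W$ can be taken to be the change set of $\langle A_{f(s)}\rangle_{s<\omega}$ for some computable approximation $\langle A_s\rangle$ of $A$ and some strictly increasing computable function $f$. -/

import Mathlib

open Filter Topology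

namespace CostFunction

/-- A set of natural numbers is `Σ⁰₂`: `x ∈ A ↔ ∃ y, ∀ z, R x y z` for a computable relation `R`. -/
def IsSigma02 (A : Set ℕ) : Prop :=
  ∃ R : ℕ → ℕ → ℕ → Bool,
    Computable (fun p : ℕ × ℕ × ℕ => R p.1 p.2.1 p.2.2) ∧
    ∀ x, x ∈ A ↔ ∃ y, ∀ z, R x y z = true

/-- A set of natural numbers is `Δ⁰₂`: it and its complement are `Σ⁰₂`. -/
def IsDelta02 (A : Set ℕ) : Prop :=
  IsSigma02 A ∧ IsSigma02 Aᶜ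

/-- A set of natural numbers is computably enumerable. -/
def IsCE (W : Set ℕ) : Prop :=
  REPred (fun n => n ∈ W)

open Classical in
/-- The characteristic function of a set, as an oracle. -/
noncomputable def charFun (A : Set ℕ) : ℕ →. ℕ :=
  fun n => Part.some (if n ∈ A then 1 else 0)

/-- `W` computes `A`: `A` is Turing reducible to `W`. -/
def Computes (W A : Set ℕ) : Prop :=
  TuringReducible (charFun A) (charFun W)

/-- `As` is a computable approximation of the set `A`: the sets `As s` are uniformly computable,
and each `As s x` is eventually constant in `s`, with limit the truth value of `x ∈ A`. -/
structure IsComputableApprox (As : ℕ → ℕ → Bool) (A : Set ℕ) : Prop where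
  computable : Computable₂ As
  eventually_eq : ∀ x, ∀ᶠ s in atTop, (As s x = true ↔ x ∈ A)

/-- A uniformly computable sequence of functions from `ℕ` to the non-negative rationals:
numerator and denominator can be computed. -/
def IsRatComputable (cs : ℕ → ℕ → ℚ) : Prop :=
  ∃ p q : ℕ → ℕ → ℕ, Computable₂ p ∧ Computable₂ q ∧
    ∀ s x, 0 < q s x ∧ cs s x = (p s x : ℚ) / (q s x : ℚ)

/-- `cs` is a monotone approximation of the function `c`. -/
structure IsMonotoneApprox (cs : ℕ → ℕ → ℚ) (c : ℕ → ℝ) : Prop where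
  computable : IsRatComputable cs
  antitone : ∀ s, Antitone (cs s)
  monotone : ∀ x, Monotone (fun s => cs s x)
  tendsto : ∀ x, Tendsto (fun s => (cs s x : ℝ)) atTop (𝓝 (c x))

/-- A monotone cost function that satisfies the limit condition: a non-increasing function from
`ℕ` to the non-negative reals with limit `0` which has a monotone approximation. (Such an
approximation is in particular a computable sequence of rational functions with limit `c`,
so `c` is a `Δ⁰₂` function.) -/
structure IsCostFunction (c : ℕ → ℝ) : Prop where
  nonneg : ∀ x, 0 ≤ c x
  antitone : Antitone c
  limit : Tendsto c atTop (𝓝 0)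
  exists_approx : ∃ cs, IsMonotoneApprox cs c

open Classical in
/-- The cost `c_{s+1}(x)` added at stage `s + 1`, where `x` is the least number whose membership
changes between stages `s` and `s + 1`; there is no cost if nothing changes. -/
noncomputable def stageCost (cs : ℕ → ℕ → ℚ) (As : ℕ → ℕ → Bool) (s : ℕ) : ℚ :=
  if h : ∃ x, As s x ≠ As (s + 1) x then cs (s + 1) (Nat.find h) else 0

/-- `A` obeys the cost function `c`: for some computable approximation of `A` and some monotone
approximation of `c`, the sum of the costs is finite (the costs are non-negative). -/
def Obeys (A : Set ℕ) (c : ℕ → ℝ) : Prop :=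
  ∃ (As : ℕ → ℕ → Bool) (cs : ℕ → ℕ → ℚ),
    IsComputableApprox As A ∧ IsMonotoneApprox cs c ∧
    Summable (fun s => (stageCost cs As s : ℝ))

/-- `IsMarker cs ε k m` says that the `k`-th marker `m_k(ε)` (for `k ≥ 1`) is defined and equal to
`m`: the first marker is `0`, and the marker after `m` is the least `s > m` with `c_s(m) ≥ ε`,
undefined if there is no such `s`. -/
inductive IsMarker (cs : ℕ → ℕ → ℚ) (ε : ℚ) : ℕ → ℕ → Prop
  | first : IsMarker cs ε 1 0
  | next {k m s : ℕ} : IsMarker cs ε k m → IsLeast {t : ℕ | m < t ∧ ε ≤ cs t m} s →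
      IsMarker cs ε (k + 1) s

/-- A cost function is benign if it has a monotone approximation for which the last `k` such that
`m_k(ε)` is defined is bounded by a computable function of the positive rational `ε = p / q`. -/
def IsBenign (c : ℕ → ℝ) : Prop :=
  IsCostFunction c ∧
  ∃ cs : ℕ → ℕ → ℚ, IsMonotoneApprox cs c ∧
    ∃ g : ℕ → ℕ → ℕ, Computable₂ g ∧
      ∀ p q : ℕ, 0 < p → 0 < q →
        ∀ k m : ℕ, IsMarker cs ((p : ℚ) / (q : ℚ)) k m → k ≤ g p q

/-- The change set of an approximation: the (coded) pairs `(x, n)` such that the membership of `x`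
changes at at least `n` stages. -/
def changeSet (Bs : ℕ → ℕ → Bool) : Set ℕ :=
  {w | ∃ x n : ℕ, w = Nat.pair x n ∧
    ∃ F : Finset ℕ, F.card = n ∧ ∀ s ∈ F, Bs (s + 1) x ≠ Bs s x}

end CostFunction

/-!
# A benign cost function whose obedient sets have c.e. covers

The cost of `x` at stage `s` is `2 ^ (-n)`, where the level `n` of `x` is initially `x` and is
lowered by requirements. A requirement follows a stream of finite sets `A_u` and a stream of
pairs of finite sets and costs `(B_v, d_v)`. Whenever `A_u` differs from the current target `B_v`
first at `x`, the requirement lowers the level of `x` step by step until the cost of `x` is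
comparable with `d_v x`. Then either `A` has to pay for returning, or `B` has to pay for following.
-/

namespace CostFunction

/-! ### The construction -/

/-! A requirement `r = pair i (pair e K)` guesses that the stream `i` lists an approximation of `A`,
that the stream `e` lists an approximation `B_v` of the same set with costs `d_v` of finite total,
and that `K` exceeds 1 plus twice the sum of the total costs of both approximations. All guesses are
treated in one construction. An inspected `A_u` which differs from the target `B_v` first at `x`,
while the cost of `x` is below `d_v x`, makes `r` lower the level of `x` by one. If nobody asks for
this, `A_u` is confirmed, and only then may targets advance. `W` is the change set of the confirmed
values.

Benignity: requirement `r` lowers to level `m` only if `r ≤ m`, and at most `K * 2 ^ m` times, where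
`K ≤ r` (`card_lowerings_le`). So the number of assignments of low levels has a computable bound,
and all but a few markers use up one such assignment (`IsMarker.le_card`).

The cap never hinders a correct guess (`card_lowerings_le_cost`, `card_lowerings_lt`). Between two
successive lowerings by `r` to level `m`, the first at `x`, the disagreement at `x` has disappeared.
Hence `A` or `B` has changed at `x` and has paid at least `2 ^ (-(m + 1))`.

`W` obeys `d` (`cost_le_of_confirmed_change`, `obeys_changeSet`). Suppose the confirmed value leaves
the last target `B_v` first at `y`. As nobody asked, the cost of `y` is at least `d_v y`, or its
level is at most `r`, which costs only a constant factor. At the next target both approximations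
agree at `y` again, so `A` has paid for moving back or `B` has paid `d_v y` for following. Since
`pair x n ≥ x`, the changes of `W` between two targets are covered by these payments. `W` depends on
`i` alone, so it serves every `d` at once. -/

/-- The value at `n` of the partial computable function with index `e`, as found within `s` steps
and decoded as an element of `α`. -/
def runFor (α : Type) [Primcodable α] (s e n : ℕ) : Option α :=
  (Nat.Partrec.Code.evaln s (Denumerable.ofNat Nat.Partrec.Code e) n).bind Encodable.decode

/-- A stage at which the construction acts leaves a record `(s, u, w, m)`: the stage `s`, the stage
`u` of the set approximation which was inspected, and either `w = 0` (the inspected value is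
confirmed) or `w = Nat.pair r x + 1`, when requirement `r` lowers the level of `x` to `m`. -/
abbrev StageRecord := ℕ × ℕ × ℕ × ℕ

/-- The requirement for which a record lowers a level. -/
def StageRecord.req (p : StageRecord) : ℕ := (p.2.2.1 - 1).unpair.1

/-- The number whose level is lowered. -/
def StageRecord.arg (p : StageRecord) : ℕ := (p.2.2.1 - 1).unpair.2

/-- The stage of the `i`-th set approximation which is to be inspected next. -/
def query (H : List StageRecord) (i : ℕ) : ℕ :=
  H.foldr (fun p acc => if p.1.unpair.1 = i then p.1 + 1 else acc) 0

/-- The level of `x` before stage `u`: the cost of `x` is `2` to the minus its level. -/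
def level (H : List StageRecord) (u x : ℕ) : ℕ :=
  H.foldr (fun p acc => if p.2.2.1 ≠ 0 ∧ p.1 < u ∧ x ≤ p.arg then min p.2.2.2 acc else acc) x

/-- How often requirement `r` has lowered a level to `m`. -/
def lowerCount (H : List StageRecord) (r m : ℕ) : ℕ :=
  H.foldr (fun p acc => if p.2.2.1 ≠ 0 ∧ p.req = r ∧ p.2.2.2 = m then acc + 1 else acc) 0

/-- The two sets described by the lists agree below `j`. -/
def AgreeBelow (a : List Bool) (b : List (Bool × ℕ × ℕ)) (j : ℕ) : Prop :=
  ∀ y < j, a.getD y false = (b.getD y (false, 0, 0)).1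

/-- The finite set given by the stream with index `i` at its stage `u`. -/
def setAt (s i u : ℕ) : List Bool := (runFor (List Bool) s i u).getD []

/-- The finite set and the costs given by the stream with index `e` at its stage `v`. -/
def costSetAt (s e v : ℕ) : List (Bool × ℕ × ℕ) := (runFor (List (Bool × ℕ × ℕ)) s e v).getD []

/-- Stage `v'` of the stream of requirement `r` can serve as the next target. -/
def IsNextTarget (s u r : ℕ) (t : ℕ × ℕ) (v' : ℕ) : Prop :=
  t.2 < v' ∧ t.1 < (setAt s r.unpair.1 u).length ∧
    t.1 < (costSetAt s r.unpair.2.unpair.1 v').length ∧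
    AgreeBelow (setAt s r.unpair.1 u) (costSetAt s r.unpair.2.unpair.1 v') (t.1 + 1)

open Classical in
/-- The next target of requirement `r`, or `0` if none can be found. -/
noncomputable def nextTarget (s u r : ℕ) (t : ℕ × ℕ) : ℕ :=
  Nat.findGreatest (fun v' => IsNextTarget s u r t v') s

/-- The target `(j, v)` of requirement `r`: `j` is the number of targets so far and `v` is the
latest one. -/
noncomputable def target (H : List StageRecord) (r : ℕ) : ℕ × ℕ :=
  H.foldr (fun p acc => if (p.1.unpair.1 = r.unpair.1 ∧ p.2.2.1 = 0 ∧ r < p.1) ∧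
    nextTarget p.1 p.2.1 r acc ≠ 0 then (acc.1 + 1, nextTarget p.1 p.2.1 r acc) else acc) (0, 0)

/-- The denominator `q` and numerator `p` satisfy `2 ^ (-n) < p / q`. -/
def CostExceeds (d : Bool × ℕ × ℕ) (n : ℕ) : Prop := d.2.2 < d.2.1 * 2 ^ n

/-- At stage `s`, the requirement coded by `w = Nat.pair r x` asks for the level of `x` to be
lowered. -/
def Asks (s : ℕ) (H : List StageRecord) (u w : ℕ) : Prop :=
  w.unpair.1.unpair.1 = s.unpair.1 ∧ w.unpair.2 < (target H w.unpair.1).1 ∧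
  AgreeBelow (setAt s s.unpair.1 u)
    (costSetAt s w.unpair.1.unpair.2.unpair.1 (target H w.unpair.1).2) w.unpair.2 ∧
  (setAt s s.unpair.1 u).getD w.unpair.2 false ≠
    ((costSetAt s w.unpair.1.unpair.2.unpair.1 (target H w.unpair.1).2).getD w.unpair.2
      (false, 0, 0)).1 ∧
  -- This condition keeps `r` from assigning levels below `r`, and the last one caps its assignments
  -- of each level. Together they give benignity, whatever the streams are.
  w.unpair.1 < level H u w.unpair.2 ∧
  CostExceeds ((costSetAt s w.unpair.1.unpair.2.unpair.1 (target H w.unpair.1).2).getD w.unpair.2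
      (false, 0, 0)) (level H u w.unpair.2) ∧
  lowerCount H w.unpair.1 (level H u w.unpair.2 - 1) <
    w.unpair.1.unpair.2.unpair.2 * 2 ^ (level H u w.unpair.2 - 1)

open Classical in
/-- The code plus one of a requirement and a number whose level is to be lowered, or `0`. -/
noncomputable def choice (s : ℕ) (H : List StageRecord) (u : ℕ) : ℕ :=
  Nat.findGreatest (fun w => w ≠ 0 ∧ Asks s H u (w - 1)) (Nat.pair s s)

/-- The record of stage `s`. -/
noncomputable def newRecord (s : ℕ) (H : List StageRecord) : StageRecord :=
  (s, query H s.unpair.1, choice s H (query H s.unpair.1),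
    level H (query H s.unpair.1) (choice s H (query H s.unpair.1) - 1).unpair.2 - 1)

/-- The records of the stages before `s`, most recent first. -/
noncomputable def history : ℕ → List StageRecord
  | 0 => []
  | s + 1 =>
    if (runFor (List Bool) s s.unpair.1 (query (history s) s.unpair.1)).isSome = true then
      newRecord s (history s) :: history s
    else history s

/-! ### The construction is primitive recursive -/

section Primrec

open Primrec

theorem primrec_two_pow : Primrec fun n : ℕ => 2 ^ n :=
  (Primrec.nat_rec₁ (f := fun _ y => 2 * y) 1
    ((Primrec.nat_mul.comp (const 2) snd).to₂)).of_eq fun n => by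
      induction n with
      | zero => rfl
      | succ n ih => exact (congrArg (2 * ·) ih).trans (pow_succ' 2 n).symm

theorem primrec_runFor (α : Type) [Primcodable α] :
    Primrec fun p : ℕ × ℕ × ℕ => runFor α p.1 p.2.1 p.2.2 :=
  Primrec.option_bind
    (Nat.Partrec.Code.primrec_evaln.comp
      (((fst).pair ((Primrec.ofNat Nat.Partrec.Code).comp (fst.comp snd))).pair (snd.comp snd)))
    ((Primrec.decode.comp snd).to₂)

theorem primrec_setAt : Primrec fun p : ℕ × ℕ × ℕ => setAt p.1 p.2.1 p.2.2 :=
  Primrec.option_getD.comp (primrec_runFor _) (const [])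

theorem primrec_costSetAt : Primrec fun p : ℕ × ℕ × ℕ => costSetAt p.1 p.2.1 p.2.2 :=
  Primrec.option_getD.comp (primrec_runFor _) (const [])

theorem primrec_req : Primrec StageRecord.req :=
  fst.comp (Primrec.unpair.comp (Primrec.pred.comp (fst.comp (snd.comp snd))))

theorem primrec_arg : Primrec StageRecord.arg :=
  snd.comp (Primrec.unpair.comp (Primrec.pred.comp (fst.comp (snd.comp snd))))

theorem primrec_query : Primrec₂ query := by
  refine Primrec.list_foldr (α := List StageRecord × ℕ) (f := fun q => q.1) (g := fun _ => 0)
    (h := fun q z => if z.1.1.unpair.1 = q.2 then z.1.1 + 1 else z.2) fst (const 0) ?_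
  refine Primrec.ite (Primrec.eq.comp ?_ ?_) ?_ ?_
  · exact fst.comp (Primrec.unpair.comp (fst.comp (fst.comp snd)))
  · exact snd.comp fst
  · exact Primrec.succ.comp (fst.comp (fst.comp snd))
  · exact snd.comp snd

theorem primrec_level :
    Primrec fun q : List StageRecord × ℕ × ℕ => level q.1 q.2.1 q.2.2 := by
  refine Primrec.list_foldr (α := List StageRecord × ℕ × ℕ) (f := fun q => q.1)
    (g := fun q => q.2.2)
    (h := fun q z => if z.1.2.2.1 ≠ 0 ∧ z.1.1 < q.2.1 ∧ q.2.2 ≤ StageRecord.arg z.1 then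
      min z.1.2.2.2 z.2 else z.2) fst (snd.comp snd) ?_
  refine Primrec.ite (PrimrecPred.and (PrimrecPred.not (Primrec.eq.comp ?_ (const 0)))
    (PrimrecPred.and (nat_lt.comp ?_ ?_) (nat_le.comp ?_ ?_))) (nat_min.comp ?_ ?_) ?_
  · exact fst.comp (snd.comp (snd.comp (fst.comp snd)))
  · exact fst.comp (fst.comp snd)
  · exact fst.comp (snd.comp fst)
  · exact snd.comp (snd.comp fst)
  · exact primrec_arg.comp (fst.comp snd)
  · exact snd.comp (snd.comp (snd.comp (fst.comp snd)))
  · exact snd.comp snd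
  · exact snd.comp snd

theorem primrec_lowerCount :
    Primrec fun q : List StageRecord × ℕ × ℕ => lowerCount q.1 q.2.1 q.2.2 := by
  refine Primrec.list_foldr (α := List StageRecord × ℕ × ℕ) (f := fun q => q.1)
    (g := fun q => 0)
    (h := fun q z => if z.1.2.2.1 ≠ 0 ∧ StageRecord.req z.1 = q.2.1 ∧ z.1.2.2.2 = q.2.2 then
      z.2 + 1 else z.2) fst (const 0) ?_
  refine Primrec.ite (PrimrecPred.and (PrimrecPred.not (Primrec.eq.comp ?_ (const 0)))
    (PrimrecPred.and (Primrec.eq.comp ?_ ?_) (Primrec.eq.comp ?_ ?_))) (succ.comp ?_) ?_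
  · exact fst.comp (snd.comp (snd.comp (fst.comp snd)))
  · exact primrec_req.comp (fst.comp snd)
  · exact fst.comp (snd.comp fst)
  · exact snd.comp (snd.comp (snd.comp (fst.comp snd)))
  · exact snd.comp (snd.comp fst)
  · exact snd.comp snd
  · exact snd.comp snd

theorem primrecPred_agreeBelow : PrimrecPred
    fun q : (List Bool × List (Bool × ℕ × ℕ)) × ℕ => AgreeBelow q.1.1 q.1.2 q.2 := by
  have : PrimrecRel fun (y : ℕ) (q : List Bool × List (Bool × ℕ × ℕ)) =>
      q.1.getD y false = (q.2.getD y (false, 0, 0)).1 :=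
    Primrec.eq.comp ((list_getD false).comp (fst.comp snd) fst)
      (fst.comp ((list_getD (false, 0, 0)).comp (snd.comp snd) fst))
  exact (PrimrecRel.comp this.forall_mem_list (list_range.comp snd) fst).of_eq fun q => by
    simp [AgreeBelow]

theorem primrecPred_isNextTarget {α : Type*} [Primcodable α] {s u r v : α → ℕ} {t : α → ℕ × ℕ}
    (hs : Primrec s) (hu : Primrec u) (hr : Primrec r) (ht : Primrec t) (hv : Primrec v) :
    PrimrecPred fun q => IsNextTarget (s q) (u q) (r q) (t q) (v q) := by
  have hr' := Primrec.unpair.comp hr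
  have ha := primrec_setAt.comp (hs.pair ((fst.comp hr').pair hu))
  have hb := primrec_costSetAt.comp
    (hs.pair ((fst.comp (Primrec.unpair.comp (snd.comp hr'))).pair hv))
  have h1 := nat_lt.comp (snd.comp ht) hv
  have h2 := nat_lt.comp (fst.comp ht) (list_length.comp ha)
  have h3 := nat_lt.comp (fst.comp ht) (list_length.comp hb)
  have h4 := primrecPred_agreeBelow.comp ((ha.pair hb).pair (succ.comp (fst.comp ht)))
  exact h1.and (h2.and (h3.and h4))

theorem primrec_nextTarget {α : Type*} [Primcodable α] {s u r : α → ℕ} {t : α → ℕ × ℕ}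
    (hs : Primrec s) (hu : Primrec u) (hr : Primrec r) (ht : Primrec t) :
    Primrec fun q => nextTarget (s q) (u q) (r q) (t q) := by
  classical
  have h : PrimrecRel fun (q : α) (v' : ℕ) => IsNextTarget (s q) (u q) (r q) (t q) v' :=
    primrecPred_isNextTarget (hs.comp fst) (hu.comp fst) (hr.comp fst) (ht.comp fst) snd
  exact (Primrec.nat_findGreatest hs h).of_eq fun q => by unfold nextTarget; congr!

theorem primrec_target : Primrec₂ target := by
  have hn : Primrec fun z : (List StageRecord × ℕ) × (StageRecord × (ℕ × ℕ)) =>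
      nextTarget z.2.1.1 z.2.1.2.1 z.1.2 z.2.2 :=
    primrec_nextTarget (fst.comp (fst.comp snd)) (fst.comp (snd.comp (fst.comp snd)))
      (snd.comp fst) (snd.comp snd)
  refine Primrec.list_foldr (α := List StageRecord × ℕ) (f := fun q => q.1)
    (g := fun _ => (0, 0))
    (h := fun q z => if (z.1.1.unpair.1 = q.2.unpair.1 ∧ z.1.2.2.1 = 0 ∧ q.2 < z.1.1) ∧
      nextTarget z.1.1 z.1.2.1 q.2 z.2 ≠ 0 then (z.2.1 + 1, nextTarget z.1.1 z.1.2.1 q.2 z.2)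
      else z.2) fst (const (0, 0)) ?_
  refine Primrec.ite (PrimrecPred.and (PrimrecPred.and (Primrec.eq.comp ?_ ?_)
    (PrimrecPred.and (Primrec.eq.comp ?_ (const 0)) (nat_lt.comp ?_ ?_)))
    (PrimrecPred.not (Primrec.eq.comp hn (const 0)))) (Primrec.pair (succ.comp ?_) hn) ?_
  · exact fst.comp (Primrec.unpair.comp (fst.comp (fst.comp snd)))
  · exact fst.comp (Primrec.unpair.comp (snd.comp fst))
  · exact fst.comp (snd.comp (snd.comp (fst.comp snd)))
  · exact snd.comp fst
  · exact fst.comp (fst.comp snd)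
  · exact fst.comp (snd.comp snd)
  · exact snd.comp snd

theorem primrecPred_costExceeds : PrimrecPred
    fun q : (Bool × ℕ × ℕ) × ℕ => CostExceeds q.1 q.2 :=
  nat_lt.comp (snd.comp (snd.comp fst))
    (nat_mul.comp (fst.comp (snd.comp fst)) (primrec_two_pow.comp snd))

theorem primrecPred_asks : PrimrecPred
    fun q : (ℕ × List StageRecord × ℕ) × ℕ => Asks q.1.1 q.1.2.1 q.1.2.2 q.2 := by
  have hs : Primrec fun q : (ℕ × List StageRecord × ℕ) × ℕ => q.1.1 := fst.comp fst
  have hH : Primrec fun q : (ℕ × List StageRecord × ℕ) × ℕ => q.1.2.1 := fst.comp (snd.comp fst)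
  have hu : Primrec fun q : (ℕ × List StageRecord × ℕ) × ℕ => q.1.2.2 := snd.comp (snd.comp fst)
  have hw : Primrec fun q : (ℕ × List StageRecord × ℕ) × ℕ => q.2.unpair := Primrec.unpair.comp snd
  have hr : Primrec fun q : (ℕ × List StageRecord × ℕ) × ℕ => q.2.unpair.1.unpair := Primrec.unpair.comp (fst.comp hw)
  have hek : Primrec fun q : (ℕ × List StageRecord × ℕ) × ℕ => q.2.unpair.1.unpair.2.unpair := Primrec.unpair.comp (snd.comp hr)
  have ht : Primrec fun q : (ℕ × List StageRecord × ℕ) × ℕ => target q.1.2.1 q.2.unpair.1 :=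
    primrec_target.comp hH (fst.comp hw)
  have hi : Primrec fun q : (ℕ × List StageRecord × ℕ) × ℕ => q.1.1.unpair.1 := fst.comp (Primrec.unpair.comp hs)
  have ha : Primrec fun q : (ℕ × List StageRecord × ℕ) × ℕ => setAt q.1.1 q.1.1.unpair.1 q.1.2.2 :=
    primrec_setAt.comp (hs.pair (hi.pair hu))
  have hb : Primrec fun q : (ℕ × List StageRecord × ℕ) × ℕ => costSetAt q.1.1 q.2.unpair.1.unpair.2.unpair.1
      (target q.1.2.1 q.2.unpair.1).2 :=
    primrec_costSetAt.comp (hs.pair ((fst.comp hek).pair (snd.comp ht)))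
  have hbx : Primrec fun q : (ℕ × List StageRecord × ℕ) × ℕ => (costSetAt q.1.1 q.2.unpair.1.unpair.2.unpair.1
      (target q.1.2.1 q.2.unpair.1).2).getD q.2.unpair.2 (false, 0, 0) :=
    (list_getD _).comp hb (snd.comp hw)
  have hn : Primrec fun q : (ℕ × List StageRecord × ℕ) × ℕ => level q.1.2.1 q.1.2.2 q.2.unpair.2 :=
    primrec_level.comp (hH.pair (hu.pair (snd.comp hw)))
  have hn1 : Primrec fun q : (ℕ × List StageRecord × ℕ) × ℕ => level q.1.2.1 q.1.2.2 q.2.unpair.2 - 1 := pred.comp hn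
  refine PrimrecPred.and (Primrec.eq.comp (fst.comp hr) hi) ?_
  refine PrimrecPred.and (nat_lt.comp (snd.comp hw) (fst.comp ht)) ?_
  refine PrimrecPred.and (primrecPred_agreeBelow.comp ((ha.pair hb).pair (snd.comp hw))) ?_
  refine PrimrecPred.and (PrimrecPred.not (Primrec.eq.comp
    ((list_getD false).comp ha (snd.comp hw)) (fst.comp hbx))) ?_
  refine PrimrecPred.and (nat_lt.comp (fst.comp hw) hn) ?_
  refine PrimrecPred.and (primrecPred_costExceeds.comp (hbx.pair hn)) ?_
  exact nat_lt.comp (primrec_lowerCount.comp (hH.pair ((fst.comp hw).pair hn1)))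
    (nat_mul.comp (snd.comp hek) (primrec_two_pow.comp hn1))

theorem primrec_choice : Primrec
    fun q : ℕ × List StageRecord × ℕ => choice q.1 q.2.1 q.2.2 := by
  classical
  have : PrimrecRel fun (q : ℕ × List StageRecord × ℕ) (w : ℕ) =>
      w ≠ 0 ∧ Asks q.1 q.2.1 q.2.2 (w - 1) :=
    PrimrecPred.and (PrimrecPred.not (Primrec.eq.comp snd (const 0)))
      (primrecPred_asks.comp (fst.pair (pred.comp snd)))
  exact (Primrec.nat_findGreatest (Primrec₂.natPair.comp fst fst) this).of_eq
      fun q => by unfold choice; congr!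

theorem primrec_newRecord : Primrec₂ newRecord := by
  have hq : Primrec fun q : ℕ × List StageRecord => query q.2 q.1.unpair.1 :=
    primrec_query.comp snd (fst.comp (Primrec.unpair.comp fst))
  have hc : Primrec fun q : ℕ × List StageRecord => choice q.1 q.2 (query q.2 q.1.unpair.1) :=
    primrec_choice.comp (fst.pair (snd.pair hq))
  exact fst.pair (hq.pair (hc.pair (pred.comp (primrec_level.comp (snd.pair (hq.pair
    (snd.comp (Primrec.unpair.comp (pred.comp hc)))))))))

theorem primrec_history : Primrec history := by
  have : Primrec₂ fun (s : ℕ) (H : List StageRecord) =>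
      if (runFor (List Bool) s s.unpair.1 (query H s.unpair.1)).isSome = true then
        newRecord s H :: H else H := by
    have h1 : Primrec fun q : ℕ × List StageRecord =>
        (q.1, q.1.unpair.1, query q.2 q.1.unpair.1) :=
      fst.pair ((fst.comp (Primrec.unpair.comp fst)).pair
        (primrec_query.comp snd (fst.comp (Primrec.unpair.comp fst))))
    have h2 := option_isSome.comp ((primrec_runFor (List Bool)).comp h1)
    exact Primrec.ite (Primrec.eq.comp h2 (const true)) (list_cons.comp primrec_newRecord snd) snd
  refine (Primrec.nat_rec₁ [] this).of_eq fun s => ?_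
  induction s with
  | zero => rfl
  | succ s ih => simp only [ih, history]

end Primrec

/-! ### Stage by stage description of the construction -/

/-- The construction acts at stage `s`. -/
def Acts (s : ℕ) : Prop :=
  (runFor (List Bool) s s.unpair.1 (query (history s) s.unpair.1)).isSome = true

/-- The set stage inspected by the stream of index `i` before stage `s`. -/
noncomputable def inspected (s i : ℕ) : ℕ := query (history s) i

/-- The level of `x` at stage `s`. -/
noncomputable def stageLevel (s x : ℕ) : ℕ := level (history s) s x

/-- The code of the lowering at stage `s`. -/
noncomputable def stageChoice (s : ℕ) : ℕ := choice s (history s) (inspected s s.unpair.1)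

/-- The requirement which lowers a level at stage `s`. -/
noncomputable def stageReq (s : ℕ) : ℕ := (stageChoice s - 1).unpair.1

/-- The number whose level is lowered at stage `s`. -/
noncomputable def stageArg (s : ℕ) : ℕ := (stageChoice s - 1).unpair.2

/-- The new level of `stageArg s`. -/
noncomputable def newLevel (s : ℕ) : ℕ :=
  level (history s) (inspected s s.unpair.1) (stageArg s) - 1

/-- A level is lowered at stage `s`. -/
def Lowers (s : ℕ) : Prop := Acts s ∧ stageChoice s ≠ 0

/-- The inspected value is confirmed at stage `s`. -/
def Confirms (s : ℕ) : Prop := Acts s ∧ stageChoice s = 0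

/-- The target of requirement `r` before stage `s`. -/
noncomputable def stageTarget (s r : ℕ) : ℕ × ℕ := target (history s) r

theorem history_succ_of_acts {s : ℕ} (h : Acts s) :
    history (s + 1) = newRecord s (history s) :: history s := by
  exact if_pos h

theorem history_succ_of_not_acts {s : ℕ} (h : ¬ Acts s) : history (s + 1) = history s := by
  exact if_neg h

theorem newRecord_history (s : ℕ) :
    newRecord s (history s) = (s, inspected s s.unpair.1, stageChoice s, newLevel s) := rfl

theorem lt_of_mem_history {s : ℕ} {p : StageRecord} (hp : p ∈ history s) : p.1 < s := by
  induction s with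
  | zero => simp [history] at hp
  | succ s ih =>
    by_cases h : Acts s
    · rw [history_succ_of_acts h, List.mem_cons] at hp
      rcases hp with rfl | hp
      · exact Nat.lt_succ_self s
      · exact (ih hp).trans (Nat.lt_succ_self s)
    · rw [history_succ_of_not_acts h] at hp
      exact (ih hp).trans (Nat.lt_succ_self s)

theorem inspected_zero (i : ℕ) : inspected 0 i = 0 := rfl

theorem inspected_succ_self {s : ℕ} (h : Acts s) : inspected (s + 1) s.unpair.1 = s + 1 := by
  simp [inspected, history_succ_of_acts h, newRecord_history, query]

theorem inspected_succ_of_ne {s i : ℕ} (h : ¬ (Acts s ∧ s.unpair.1 = i)) :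
    inspected (s + 1) i = inspected s i := by
  by_cases h' : Acts s
  · have : s.unpair.1 ≠ i := fun h'' => h ⟨h', h''⟩
    simp [inspected, history_succ_of_acts h', newRecord_history, query, this]
  · simp [inspected, history_succ_of_not_acts h']

theorem inspected_le (s i : ℕ) : inspected s i ≤ s := by
  induction s with
  | zero => simp [inspected_zero]
  | succ s ih =>
    by_cases h : Acts s ∧ s.unpair.1 = i
    · rw [← h.2, inspected_succ_self h.1]
    · rw [inspected_succ_of_ne h]; omega

theorem monotone_inspected (i : ℕ) : Monotone fun s => inspected s i := by
  refine monotone_nat_of_le_succ fun s => ?_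
  by_cases h : Acts s ∧ s.unpair.1 = i
  · rw [← h.2, inspected_succ_self h.1, h.2]
    exact (inspected_le s i).trans (Nat.le_succ s)
  · rw [inspected_succ_of_ne h]

/-- A level lowered at stage `s` is thus already in force at every set stage which the stream
inspects later, so later changes of the set are charged at the new level. -/
theorem lt_inspected {s t i : ℕ} (hs : Acts s) (hi : s.unpair.1 = i) (h : s < t) :
    s < inspected t i := by
  have : inspected (s + 1) i ≤ inspected t i := monotone_inspected i h
  rw [← hi, inspected_succ_self hs, hi] at this
  exact this

theorem level_history_eq {s u : ℕ} (h : u ≤ s) (x : ℕ) :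
    level (history s) u x = stageLevel u x := by
  induction s with
  | zero => obtain rfl : u = 0 := by omega
            rfl
  | succ s ih =>
    rcases h.eq_or_lt with rfl | h
    · rfl
    · rw [← ih (by omega)]
      by_cases h' : Acts s
      · have : ¬ s < u := by omega
        simp [history_succ_of_acts h', newRecord_history, level, this]
      · rw [history_succ_of_not_acts h']

theorem level_succ_history (s x : ℕ) : level (history s) (s + 1) x = stageLevel s x := by
  have : ∀ H : List StageRecord, (∀ p ∈ H, p.1 < s) → level H (s + 1) x = level H s x := by
    intro H hH
    induction H with
    | nil => rfl
    | cons p H ih =>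
      have h1 : p.1 < s + 1 ↔ p.1 < s :=
        ⟨fun _ => hH p (by simp), fun h => h.trans (Nat.lt_succ_self s)⟩
      have h2 := ih fun p hp => hH p (by simp [hp])
      simp only [level, List.foldr_cons, h1] at h2 ⊢
      rw [h2]
  exact this _ fun p hp => lt_of_mem_history hp

theorem stageLevel_zero (x : ℕ) : stageLevel 0 x = x := rfl

theorem newLevel_eq (s : ℕ) :
    newLevel s = stageLevel (inspected s s.unpair.1) (stageArg s) - 1 := by
  rw [newLevel, level_history_eq (inspected_le _ _)]

theorem stageLevel_succ_of_lowers {s x : ℕ} (h : Lowers s) (hx : x ≤ stageArg s) :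
    stageLevel (s + 1) x = min (newLevel s) (stageLevel s x) := by
  rw [← level_succ_history s x, stageLevel, history_succ_of_acts h.1, newRecord_history, level,
    List.foldr_cons, if_pos]
  · rfl
  · exact ⟨h.2, Nat.lt_succ_self s, hx⟩

theorem stageLevel_succ_of_not {s x : ℕ} (h : ¬ (Lowers s ∧ x ≤ stageArg s)) :
    stageLevel (s + 1) x = stageLevel s x := by
  by_cases h' : Acts s
  · rw [← level_succ_history s x, stageLevel, history_succ_of_acts h', newRecord_history, level,
      List.foldr_cons, if_neg]
    · rfl
    · exact fun h'' => h ⟨⟨h', h''.1⟩, h''.2.2⟩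
  · rw [← level_succ_history s x, stageLevel, history_succ_of_not_acts h']

theorem antitone_stageLevel (x : ℕ) : Antitone fun s => stageLevel s x := by
  refine antitone_nat_of_succ_le fun s => ?_
  by_cases h : Lowers s ∧ x ≤ stageArg s
  · rw [stageLevel_succ_of_lowers h.1 h.2]; exact min_le_right _ _
  · rw [stageLevel_succ_of_not h]

theorem monotone_stageLevel (s : ℕ) : Monotone (stageLevel s) := by
  induction s with
  | zero => exact fun x y h => h
  | succ s ih =>
    intro x y hxy
    by_cases h : Lowers s ∧ y ≤ stageArg s
    · rw [stageLevel_succ_of_lowers h.1 h.2, stageLevel_succ_of_lowers h.1 (hxy.trans h.2)]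
      exact min_le_min le_rfl (ih hxy)
    · rw [stageLevel_succ_of_not h]
      exact (antitone_stageLevel x (Nat.le_succ s)).trans (ih hxy)

theorem lowerCount_succ (s r m : ℕ) : lowerCount (history (s + 1)) r m =
    lowerCount (history s) r m + (open Classical in
      if Lowers s ∧ stageReq s = r ∧ newLevel s = m then 1 else 0) := by
  by_cases h : Acts s
  · rw [history_succ_of_acts h, newRecord_history, lowerCount, List.foldr_cons]
    by_cases h' : Lowers s ∧ stageReq s = r ∧ newLevel s = m
    · rw [if_pos h', if_pos ⟨h'.1.2, h'.2⟩]; rfl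
    · rw [if_neg h', if_neg fun h'' => h' ⟨⟨h, h''.1⟩, h''.2⟩]; rfl
  · rw [history_succ_of_not_acts h, if_neg fun h' => h h'.1.1, add_zero]

/-- The stages before `s` at which requirement `r` lowers a level to `m`. -/
noncomputable def lowerings (s r m : ℕ) : Finset ℕ :=
  open Classical in
  (Finset.range s).filter fun t => Lowers t ∧ stageReq t = r ∧ newLevel t = m

theorem mem_lowerings {s r m t : ℕ} :
    t ∈ lowerings s r m ↔ t < s ∧ Lowers t ∧ stageReq t = r ∧ newLevel t = m := by
  simp [lowerings]

theorem lowerCount_eq_card (s r m : ℕ) :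
    lowerCount (history s) r m = (lowerings s r m).card := by
  classical
  induction s with
  | zero => rfl
  | succ s ih =>
    rw [lowerCount_succ, ih, lowerings, lowerings, Finset.range_add_one, Finset.filter_insert]
    split_ifs with h
    · rw [Finset.card_insert_of_notMem (by simp)]
    · rfl

/-! ### Targets -/

theorem nextTarget_spec {s u r : ℕ} {t : ℕ × ℕ} (h : nextTarget s u r t ≠ 0) :
    IsNextTarget s u r t (nextTarget s u r t) := by
  classical
  unfold nextTarget at h ⊢
  exact Nat.findGreatest_of_ne_zero rfl h

theorem nextTarget_ne_zero {s u r v : ℕ} {t : ℕ × ℕ} (hv : v ≤ s)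
    (h : IsNextTarget s u r t v) : nextTarget s u r t ≠ 0 := by
  classical
  unfold nextTarget
  have h0 : 0 < v := Nat.zero_lt_of_lt h.1
  have := Nat.le_findGreatest (P := fun v => IsNextTarget s u r t v) hv h
  omega

/-- The target of requirement `r` changes at stage `s`. -/
def Advances (s r : ℕ) : Prop :=
  (Confirms s ∧ s.unpair.1 = r.unpair.1 ∧ r < s) ∧
    nextTarget s (inspected s s.unpair.1) r (stageTarget s r) ≠ 0

theorem stageTarget_zero (r : ℕ) : stageTarget 0 r = (0, 0) := rfl

theorem stageTarget_succ_of_advances {s r : ℕ} (h : Advances s r) : stageTarget (s + 1) r =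
    ((stageTarget s r).1 + 1, nextTarget s (inspected s s.unpair.1) r (stageTarget s r)) := by
  rw [stageTarget, history_succ_of_acts h.1.1.1, newRecord_history, target, List.foldr_cons,
    if_pos]
  · rfl
  · exact ⟨⟨h.1.2.1, h.1.1.2, h.1.2.2⟩, h.2⟩

theorem stageTarget_succ_of_not {s r : ℕ} (h : ¬ Advances s r) :
    stageTarget (s + 1) r = stageTarget s r := by
  by_cases h' : Acts s
  · rw [stageTarget, history_succ_of_acts h', newRecord_history, target, List.foldr_cons, if_neg]
    · rfl
    · exact fun h'' => h ⟨⟨⟨h', h''.1.2.1⟩, h''.1.1, h''.1.2.2⟩, h''.2⟩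
  · rw [stageTarget, history_succ_of_not_acts h']; rfl

theorem Advances.isNextTarget {s r : ℕ} (h : Advances s r) :
    IsNextTarget s (inspected s r.unpair.1) r (stageTarget s r) (stageTarget (s + 1) r).2 := by
  rw [stageTarget_succ_of_advances h, ← h.1.2.1]
  exact nextTarget_spec h.2

theorem Advances.lt {s r : ℕ} (h : Advances s r) :
    (stageTarget s r).2 < (stageTarget (s + 1) r).2 :=
  h.isNextTarget.1

theorem monotone_stageTarget_snd (r : ℕ) : Monotone fun s => (stageTarget s r).2 := by
  refine monotone_nat_of_le_succ fun s => ?_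
  by_cases h : Advances s r
  · exact h.lt.le
  · rw [stageTarget_succ_of_not h]

theorem stageTarget_fst_le (s r : ℕ) : (stageTarget s r).1 ≤ s := by
  induction s with
  | zero => simp [stageTarget_zero]
  | succ s ih =>
    by_cases h : Advances s r
    · rw [stageTarget_succ_of_advances h]; simpa using ih
    · rw [stageTarget_succ_of_not h]; omega

theorem lt_of_stageTarget_fst_pos {s r : ℕ} (hs : 0 < (stageTarget s r).1) : r < s := by
  induction s with
  | zero => simp [stageTarget_zero] at hs
  | succ s ih =>
    by_cases h : Advances s r
    · have := h.1.2.2; omega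
    · rw [stageTarget_succ_of_not h] at hs
      have := ih hs; omega

/-! ### Lowerings -/

theorem asks_of_lowers {s : ℕ} (h : Lowers s) :
    Asks s (history s) (inspected s s.unpair.1) (stageChoice s - 1) := by
  classical
  have h2 := h.2
  unfold stageChoice choice at h2 ⊢
  exact (Nat.findGreatest_of_ne_zero rfl h2).2

/-- The search bound `Nat.pair s s` misses no request: both the requirement and the number which it
wants lowered are below `s`. -/
theorem not_asks_of_confirms {s w : ℕ} (h : Confirms s) :
    ¬ Asks s (history s) (inspected s s.unpair.1) w := by
  classical
  intro hw
  have h1 : w.unpair.2 < (stageTarget s w.unpair.1).1 := hw.2.1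
  have h2 : w.unpair.1 < s := lt_of_stageTarget_fst_pos (Nat.zero_lt_of_lt h1)
  have h3 : w.unpair.2 < s := h1.trans_le (stageTarget_fst_le _ _)
  have h4 : w < Nat.pair s s := by
    rw [← Nat.pair_unpair w]
    exact (Nat.pair_lt_pair_left _ h2).trans (Nat.pair_lt_pair_right _ h3)
  have h5 := h.2
  unfold stageChoice choice at h5
  rw [Nat.findGreatest_eq_zero_iff] at h5
  exact h5 (Nat.succ_pos w) h4 ⟨Nat.succ_ne_zero w, by simpa using hw⟩


theorem stageReq_unpair {s : ℕ} (h : Lowers s) : (stageReq s).unpair.1 = s.unpair.1 :=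
  (asks_of_lowers h).1

theorem stageArg_lt {s : ℕ} (h : Lowers s) : stageArg s < (stageTarget s (stageReq s)).1 :=
  (asks_of_lowers h).2.1

theorem stageArg_lt_self {s : ℕ} (h : Lowers s) : stageArg s < s :=
  (stageArg_lt h).trans_le (stageTarget_fst_le _ _)

theorem stageReq_lt_level {s : ℕ} (h : Lowers s) :
    stageReq s < stageLevel (inspected s s.unpair.1) (stageArg s) := by
  rw [← level_history_eq (inspected_le s _)]
  exact (asks_of_lowers h).2.2.2.2.1

theorem newLevel_add_one {s : ℕ} (h : Lowers s) :
    newLevel s + 1 = stageLevel (inspected s s.unpair.1) (stageArg s) := by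
  have := stageReq_lt_level h
  rw [newLevel_eq]; omega

theorem stageReq_le_newLevel {s : ℕ} (h : Lowers s) : stageReq s ≤ newLevel s := by
  have := stageReq_lt_level h
  rw [newLevel_eq]; omega

/-- The cap is tested before each lowering. The bound needs no assumption on the streams, so wrong
guesses cannot spoil benignity. -/
theorem card_lowerings_le (s r m : ℕ) :
    (lowerings s r m).card ≤ r.unpair.2.unpair.2 * 2 ^ m := by
  induction s with
  | zero => simp [lowerings]
  | succ s ih =>
    rw [← lowerCount_eq_card] at ih ⊢
    rw [lowerCount_succ]
    split_ifs with h
    · have h1 := (asks_of_lowers h.1).2.2.2.2.2.2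
      have h2 : level (history s) (inspected s s.unpair.1) (stageChoice s - 1).unpair.2 - 1 =
        newLevel s := rfl
      have h3 : (stageChoice s - 1).unpair.1 = stageReq s := rfl
      rw [h2, h3, h.2.1, h.2.2] at h1
      exact h1
    · exact ih

theorem exists_lowers_of_stageLevel_lt {s x : ℕ} (h : stageLevel s x < x) :
    ∃ t < s, Lowers t ∧ x ≤ stageArg t ∧ newLevel t = stageLevel s x := by
  induction s with
  | zero => simp [stageLevel_zero] at h
  | succ s ih =>
    by_cases hs : Lowers s ∧ x ≤ stageArg s ∧ newLevel s ≤ stageLevel s x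
    · refine ⟨s, Nat.lt_succ_self s, hs.1, hs.2.1, ?_⟩
      rw [stageLevel_succ_of_lowers hs.1 hs.2.1, min_eq_left hs.2.2]
    · have : stageLevel (s + 1) x = stageLevel s x := by
        by_cases h' : Lowers s ∧ x ≤ stageArg s
        · rw [stageLevel_succ_of_lowers h'.1 h'.2, min_eq_right]
          by_contra h''
          exact hs ⟨h'.1, h'.2, by omega⟩
        · exact stageLevel_succ_of_not h'
      rw [this] at h ⊢
      obtain ⟨t, ht, h1⟩ := ih h
      exact ⟨t, by omega, h1⟩

theorem stageLevel_le_self (s x : ℕ) : stageLevel s x ≤ x :=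
  antitone_stageLevel x (Nat.zero_le s)

/-- A lowering at stage `t` reaches only numbers below `t`. Hence early changes at large numbers are
cheap. -/
theorem stageLevel_eq_self {s x : ℕ} (h : s ≤ x + 1) : stageLevel s x = x := by
  by_contra hne
  obtain ⟨t, ht, h1, h2, -⟩ :=
    exists_lowers_of_stageLevel_lt (lt_of_le_of_ne (stageLevel_le_self s x) hne)
  have := stageArg_lt_self h1
  omega

/-! ### Computability of the stage functions -/

section Primrec

open Primrec

theorem primrec_inspected : Primrec₂ inspected :=
  primrec_query.comp (primrec_history.comp fst) snd

theorem primrec_stageLevel : Primrec₂ stageLevel :=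
  primrec_level.comp ((primrec_history.comp fst).pair (fst.pair snd))

theorem primrec_stageTarget : Primrec₂ stageTarget :=
  primrec_target.comp (primrec_history.comp fst) snd

theorem primrec_stageChoice : Primrec stageChoice :=
  primrec_choice.comp (Primrec.id.pair (primrec_history.pair
    (primrec_inspected.comp Primrec.id (fst.comp Primrec.unpair))))

theorem primrecPred_acts : PrimrecPred Acts := by
  have h1 : Primrec fun s : ℕ => (s, s.unpair.1, query (history s) s.unpair.1) :=
    Primrec.id.pair ((fst.comp Primrec.unpair).pair
      (primrec_inspected.comp Primrec.id (fst.comp Primrec.unpair)))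
  exact Primrec.eq.comp (option_isSome.comp ((primrec_runFor (List Bool)).comp h1)) (const true)

theorem primrecPred_confirms : PrimrecPred Confirms :=
  primrecPred_acts.and (Primrec.eq.comp primrec_stageChoice (const 0))

theorem advances_iff (s r : ℕ) : Advances s r ↔ stageTarget (s + 1) r ≠ stageTarget s r := by
  constructor
  · intro h h'
    have := h.lt
    rw [h'] at this
    exact lt_irrefl _ this
  · intro h
    by_contra h'
    exact h (stageTarget_succ_of_not h')

theorem primrecRel_advances : PrimrecRel Advances :=
  (PrimrecPred.not (Primrec.eq.comp (primrec_stageTarget.comp (succ.comp fst) snd)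
    (primrec_stageTarget.comp fst snd))).of_eq fun q => (advances_iff q.1 q.2).symm

end Primrec

/-! ### The benign cost function -/

/-- The canonical approximation of the cost function. -/
noncomputable def stageCostFun (s x : ℕ) : ℚ := 1 / 2 ^ stageLevel s x

/-- The limit of the levels of `x`. -/
noncomputable def limitLevel (x : ℕ) : ℕ := sInf (Set.range fun s => stageLevel s x)

/-- The limit of the canonical approximation. -/
noncomputable def costFun (x : ℕ) : ℝ := 1 / 2 ^ limitLevel x

theorem eventually_stageLevel_eq (x : ℕ) : ∀ᶠ s in atTop, stageLevel s x = limitLevel x := by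
  obtain ⟨s, hs⟩ := Nat.sInf_mem (Set.range_nonempty fun s => stageLevel s x)
  filter_upwards [eventually_ge_atTop s] with t ht
  refine le_antisymm ?_ (Nat.sInf_le ⟨t, rfl⟩)
  rw [limitLevel, ← hs]
  exact antitone_stageLevel x ht

theorem stageCostFun_pos (s x : ℕ) : 0 < stageCostFun s x := by
  unfold stageCostFun; positivity

theorem stageCostFun_le_iff {s x t y : ℕ} :
    stageCostFun s x ≤ stageCostFun t y ↔ stageLevel t y ≤ stageLevel s x := by
  unfold stageCostFun
  rw [one_div_le_one_div (by positivity) (by positivity)]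
  exact pow_le_pow_iff_right₀ (by norm_num)

theorem antitone_stageCostFun (s : ℕ) : Antitone (stageCostFun s) := fun _ _ h =>
  stageCostFun_le_iff.2 (monotone_stageLevel s h)

theorem monotone_stageCostFun (x : ℕ) : Monotone fun s => stageCostFun s x := fun _ _ h =>
  stageCostFun_le_iff.2 (antitone_stageLevel x h)

theorem isMonotoneApprox_stageCostFun : IsMonotoneApprox stageCostFun costFun where
  computable := ⟨fun _ _ => 1, fun s x => 2 ^ stageLevel s x, Computable.const 1,
    (primrec_two_pow.comp₂ primrec_stageLevel).to_comp, fun s x => ⟨by positivity, by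
      simp [stageCostFun]⟩⟩
  antitone := antitone_stageCostFun
  monotone := monotone_stageCostFun
  tendsto x := by
    refine tendsto_const_nhds.congr' ?_
    filter_upwards [eventually_stageLevel_eq x] with s hs
    simp [stageCostFun, costFun, hs]

theorem stageCostFun_le_costFun (s x : ℕ) : (stageCostFun s x : ℝ) ≤ costFun x :=
  Monotone.ge_of_tendsto (f := fun s => (stageCostFun s x : ℝ))
    (fun _ _ h => Rat.cast_le.2 (monotone_stageCostFun x h))
    (isMonotoneApprox_stageCostFun.tendsto x) s

/-! ### Counting markers: the limit condition and benignity -/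

theorem IsMarker.pred_le {cs : ℕ → ℕ → ℚ} {ε : ℚ} {k m : ℕ} (h : IsMarker cs ε k m) :
    k ≤ m + 1 := by
  induction h with
  | first => omega
  | next _ hs ih => have := hs.1.1; omega

/-- The stages before `s` at which a level below `b` is assigned. -/
noncomputable def lowStages (s b : ℕ) : Finset ℕ :=
  open Classical in (Finset.range s).filter fun t => Lowers t ∧ newLevel t < b

/-- A level `m < b` is assigned only by some `r ≤ m`. There are at most `b * b` such pairs, and the
parameter `K` coded in `r` is below `b` too. -/
theorem card_lowStages_le (s b : ℕ) : (lowStages s b).card ≤ b * b * (b * 2 ^ b) := by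
  have h1 : lowStages s b ⊆
      (Finset.range b ×ˢ Finset.range b).biUnion fun p => lowerings s p.1 p.2 := by
    intro t ht
    simp only [lowStages, Finset.mem_filter, Finset.mem_range] at ht
    simp only [Finset.mem_biUnion, Finset.mem_product, Finset.mem_range, mem_lowerings]
    exact ⟨(stageReq t, newLevel t), ⟨(stageReq_le_newLevel ht.2.1).trans_lt ht.2.2, ht.2.2⟩,
      ht.1, ht.2.1, rfl, rfl⟩
  refine (Finset.card_le_card h1).trans ((Finset.card_biUnion_le_card_mul _ _ (b * 2 ^ b) ?_).trans
    (by simp))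
  rintro ⟨r, m⟩ h
  simp only [Finset.mem_product, Finset.mem_range] at h
  refine (card_lowerings_le s r m).trans (Nat.mul_le_mul ?_ (Nat.pow_le_pow_right (by norm_num)
    h.2.le))
  exact ((Nat.unpair_right_le _).trans (Nat.unpair_right_le _)).trans h.1.le

theorem stageLevel_lt_of_le {p q s x : ℕ} (hp : 0 < p) (hq : 0 < q)
    (h : (p : ℚ) / q ≤ stageCostFun s x) : stageLevel s x < q := by
  unfold stageCostFun at h
  rw [div_le_div_iff₀ (by positivity) (by positivity), one_mul] at h
  have h' : p * 2 ^ stageLevel s x ≤ q := by exact_mod_cast h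
  calc stageLevel s x < 2 ^ stageLevel s x := Nat.lt_two_pow_self
    _ ≤ p * 2 ^ stageLevel s x := Nat.le_mul_of_pos_left _ hp
    _ ≤ q := h'

/-- If the cost of the marker `m` has reached `p / q` at stage `s`, its level is below `q`. Either
the level is still `m`, so `m < q` and few markers came before; or it was set at a stage strictly
between `m` and `s`, which is a new element of `lowStages`. -/
theorem IsMarker.le_card {p q k m : ℕ} (hp : 0 < p) (hq : 0 < q)
    (h : IsMarker stageCostFun ((p : ℚ) / q) k m) : k ≤ q + 1 + (lowStages m q).card := by
  induction h with
  | first => omega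
  | @next k m s hk hs ih =>
    have h1 := stageLevel_lt_of_le hp hq hs.1.2
    rcases (stageLevel_le_self s m).eq_or_lt with h2 | h2
    · have := hk.pred_le
      omega
    · obtain ⟨t, hts, ht, hm, hl⟩ := exists_lowers_of_stageLevel_lt h2
      have h3 : insert t (lowStages m q) ⊆ lowStages s q := by
        intro z hz
        simp only [lowStages, Finset.mem_insert, Finset.mem_filter, Finset.mem_range] at hz ⊢
        rcases hz with rfl | hz
        · exact ⟨hts, ht, hl.trans_lt h1⟩
        · exact ⟨hz.1.trans hs.1.1, hz.2⟩
      have h4 : t ∉ lowStages m q := by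
        have := stageArg_lt_self ht
        simp only [lowStages, Finset.mem_filter, Finset.mem_range]
        omega
      have h5 := Finset.card_le_card h3
      rw [Finset.card_insert_of_notMem h4] at h5
      omega

theorem exists_isMarker {cs : ℕ → ℕ → ℚ} {ε : ℚ} (h : ∀ m, ∃ s > m, ε ≤ cs s m) (k : ℕ) :
    ∃ m, IsMarker cs ε (k + 1) m := by
  classical
  induction k with
  | zero => exact ⟨0, .first⟩
  | succ k ih =>
    obtain ⟨m, hm⟩ := ih
    exact ⟨_, hm.next ⟨Nat.find_spec (h m), fun t ht => Nat.find_min' (h m) ht⟩⟩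

/-- If the costs stayed above some `ε`, every marker would have a successor, against the bound on
their number. -/
theorem tendsto_costFun : Tendsto costFun atTop (𝓝 0) := by
  rw [Metric.tendsto_atTop]
  intro δ hδ
  obtain ⟨n, hn⟩ := exists_nat_one_div_lt hδ
  have h1 : ∃ m, ∀ s > m, stageCostFun s m < ((1 : ℕ) : ℚ) / ((n + 1 : ℕ) : ℚ) := by
    by_contra! hc
    obtain ⟨m, hm⟩ := exists_isMarker hc
      (n + 1 + 1 + (n + 1) * (n + 1) * ((n + 1) * 2 ^ (n + 1)))
    exact absurd ((hm.le_card Nat.one_pos (Nat.succ_pos n)).trans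
      (Nat.add_le_add_left (card_lowStages_le m (n + 1)) _)) (Nat.not_succ_le_self _)
  obtain ⟨m, hm⟩ := h1
  refine ⟨m, fun x hx => ?_⟩
  have h2 : costFun x ≤ 1 / (n + 1) := by
    refine le_of_tendsto (isMonotoneApprox_stageCostFun.tendsto x) ?_
    filter_upwards [eventually_gt_atTop m] with s hs
    have h3 := (antitone_stageCostFun s hx).trans (hm s hs).le
    have h4 : (stageCostFun s x : ℝ) ≤ (((1 : ℕ) : ℚ) / ((n + 1 : ℕ) : ℚ) : ℚ) := by
      exact_mod_cast h3
    simpa using h4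
  have h5 : 0 ≤ costFun x := by unfold costFun; positivity
  rw [Real.dist_eq, sub_zero, abs_of_nonneg h5]
  exact h2.trans_lt hn

theorem isBenign_costFun : IsBenign costFun := by
  refine ⟨⟨fun x => by unfold costFun; positivity, fun x y h => ?_, tendsto_costFun, _,
    isMonotoneApprox_stageCostFun⟩, _, isMonotoneApprox_stageCostFun,
    fun _ q => q + 1 + q * q * (q * 2 ^ q), ?_, fun p q hp hq k m h => ?_⟩
  · exact le_of_tendsto_of_tendsto' (isMonotoneApprox_stageCostFun.tendsto y)
      (isMonotoneApprox_stageCostFun.tendsto x) fun s => by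
        exact_mod_cast antitone_stageCostFun s h
  · have : Primrec fun q : ℕ => q + 1 + q * q * (q * 2 ^ q) :=
      Primrec.nat_add.comp Primrec.succ (Primrec.nat_mul.comp
        (Primrec.nat_mul.comp Primrec.id Primrec.id)
        (Primrec.nat_mul.comp Primrec.id primrec_two_pow))
    exact (this.comp Primrec.snd).to_comp
  · exact (h.le_card hp hq).trans (Nat.add_le_add_left (card_lowStages_le m q) _)

/-! ### Computability -/

section Computability

variable {α β : Type*} [Primcodable α] [Primcodable β]

theorem computablePred_and {p q : α → Prop} (hp : ComputablePred p) (hq : ComputablePred q) :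
    ComputablePred fun a => p a ∧ q a := by
  classical
  exact (Computable.computablePred (((Primrec.dom_bool₂ and).to_comp.comp hp.decide
    hq.decide).of_eq fun a => by simp))

theorem computablePred_comp {p : α → Prop} (hp : ComputablePred p) {f : β → α}
    (hf : Computable f) : ComputablePred fun b => p (f b) := by
  classical
  exact Computable.computablePred (hp.decide.comp hf)

theorem computablePred_le {f g : α → ℕ} (hf : Computable f) (hg : Computable g) :
    ComputablePred fun a => f a ≤ g a :=
  computablePred_comp (p := fun q : ℕ × ℕ => q.1 ≤ q.2)
    (PrimrecPred.computablePred Primrec.nat_le) (hf.pair hg)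

theorem computablePred_ne {f g : α → Bool} (hf : Computable f) (hg : Computable g) :
    ComputablePred fun a => f a ≠ g a :=
  computablePred_comp (p := fun q : Bool × Bool => q.1 ≠ q.2)
    (PrimrecPred.computablePred (PrimrecPred.not (Primrec.eq.comp Primrec.fst Primrec.snd)))
      (hf.pair hg)

open Classical in
theorem computable_ite {p : α → Prop} (hp : ComputablePred p) {f g : α → β} (hf : Computable f)
    (hg : Computable g) : Computable fun a => if p a then f a else g a := by
  simpa [Bool.cond_decide] using hp.decide.cond hf hg

open Classical in
theorem computable_count {R : α → ℕ → Prop} (hR : ComputablePred fun p : α × ℕ => R p.1 p.2) :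
    Computable₂ fun a n => Nat.count (R a) n := by
  have h : Computable₂ fun (p : α × ℕ) (q : ℕ × ℕ) => q.2 + if R p.1 q.1 then 1 else 0 :=
    Primrec.nat_add.to_comp.comp (Computable.snd.comp Computable.snd)
      (computable_ite (computablePred_comp hR
        ((Computable.fst.comp Computable.fst).pair (Computable.fst.comp Computable.snd)))
        (Computable.const 1) (Computable.const 0))
  refine (Computable.nat_rec (f := fun p : α × ℕ => p.2) (g := fun _ => 0)
    (h := fun p q => q.2 + if R p.1 q.1 then 1 else 0) Computable.snd (Computable.const 0)
    h).of_eq fun p => ?_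
  obtain ⟨a, n⟩ := p
  induction n with
  | zero => simp
  | succ n ih => simp only [Nat.count_succ] at ih ⊢; rw [ih]

theorem computable_nth {P : ℕ → Prop} (hP : ComputablePred P) (hinf : {n | P n}.Infinite) :
    Computable (Nat.nth P) := by
  classical
  have h : ∀ n, ∃ s, P s ∧ Nat.count P s = n := fun n =>
    ⟨Nat.nth P n, Nat.nth_mem_of_infinite hinf n, Nat.count_nth_of_infinite hinf n⟩
  have h1 : Computable₂ fun (_ : ℕ) n => Nat.count P n :=
    (computable_count (R := fun (_ : ℕ) => P) (computablePred_comp hP Computable.snd)).of_eq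
      fun q => by congr!
  have h2 : ComputablePred fun q : ℕ × ℕ => P q.2 ∧ Nat.count P q.2 = q.1 :=
    computablePred_and (computablePred_comp hP Computable.snd)
      (computablePred_comp (p := fun q : ℕ × ℕ => q.1 = q.2)
        (PrimrecPred.computablePred Primrec.eq)
        ((h1.comp Computable.fst Computable.snd).pair Computable.fst))
  refine (Computable.find (P := fun n s => P s ∧ Nat.count P s = n) h2 h).of_eq fun n => ?_
  have h3 := Nat.find_spec (h n)
  rw [← Nat.nth_count h3.1, h3.2]

theorem rePred_exists {R : α → ℕ → Prop} (hR : ComputablePred fun p : α × ℕ => R p.1 p.2) :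
    REPred fun a => ∃ n, R a n := by
  classical
  have h : Partrec fun a => Nat.rfind fun n => Part.some (decide (R a n)) :=
    Partrec.rfind hR.decide.partrec
  refine h.dom_re.of_eq fun a => Nat.rfind_dom.trans ?_
  constructor
  · rintro ⟨n, hn, -⟩; exact ⟨n, by simpa using hn⟩
  · rintro ⟨n, hn⟩; exact ⟨n, by simpa using hn, fun _ => trivial⟩

/-- A computable choice of increasing witnesses. -/
theorem exists_computable_strictMono {R : ℕ → ℕ → Prop}
    (hR : ComputablePred fun p : ℕ × ℕ => R p.1 p.2) (h : ∀ n, ∃ᶠ m in atTop, R n m) :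
    ∃ f : ℕ → ℕ, Computable f ∧ StrictMono f ∧ ∀ n, R n (f n) := by
  classical
  have h1 : ∀ p : ℕ × ℕ, ∃ m, p.2 ≤ m ∧ R p.1 m := fun p => by
    obtain ⟨m, hm, hr⟩ := (frequently_atTop.1 (h p.1)) p.2
    exact ⟨m, hm, hr⟩
  have h2 : ComputablePred fun q : (ℕ × ℕ) × ℕ => q.1.2 ≤ q.2 ∧ R q.1.1 q.2 :=
    computablePred_and (computablePred_le (Computable.snd.comp Computable.fst) Computable.snd)
      (computablePred_comp hR ((Computable.fst.comp Computable.fst).pair Computable.snd))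
  have h3 := Computable.find (P := fun (p : ℕ × ℕ) m => p.2 ≤ m ∧ R p.1 m) h2 h1
  let F : ℕ × ℕ → ℕ := fun p => Nat.find (h1 p)
  have hF : ∀ p, p.2 ≤ F p ∧ R p.1 (F p) := fun p => Nat.find_spec (h1 p)
  let f : ℕ → ℕ := fun n => Nat.rec (F (0, 0)) (fun k y => F (k + 1, y + 1)) n
  have h4 : Computable₂ fun (_ : ℕ) (q : ℕ × ℕ) => F (q.1 + 1, q.2 + 1) :=
    h3.comp ((Computable.succ.comp (Computable.fst.comp Computable.snd)).pair
      (Computable.succ.comp (Computable.snd.comp Computable.snd)))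
  refine ⟨f, Computable.nat_rec Computable.id (Computable.const _) h4,
    strictMono_nat_of_lt_succ fun n => ?_, fun n => ?_⟩
  · exact (hF (n + 1, f n + 1)).1
  · cases n with
    | zero => exact (hF (0, 0)).2
    | succ n => exact (hF (n + 1, f n + 1)).2

theorem computable_map_range {f : ℕ → ℕ → β} (hf : Computable₂ f) :
    Computable fun n => (List.range n).map (f n) := by
  have h : Computable₂ fun (n : ℕ) (q : ℕ × List β) => q.2 ++ [f n q.1] :=
    Computable.list_concat.comp (Computable.snd.comp Computable.snd)
      (hf.comp Computable.fst (Computable.fst.comp Computable.snd))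
  have h2 : Computable fun p : ℕ × ℕ => (List.range p.2).map (f p.1) := by
    refine (Computable.nat_rec (f := fun p : ℕ × ℕ => p.2) (g := fun _ => ([] : List β))
      (h := fun p q => q.2 ++ [f p.1 q.1]) Computable.snd (Computable.const [])
      (h.comp (Computable.fst.comp Computable.fst) Computable.snd)).of_eq fun p => ?_
    obtain ⟨a, n⟩ := p
    induction n with
    | zero => rfl
    | succ n ih => simp only [List.range_succ, List.map_append] at ih ⊢; rw [ih]; rfl
  exact h2.comp (Computable.id.pair Computable.id)

theorem exists_index {f : ℕ → β} (hf : Computable f) : ∃ i, ∀ n, Encodable.encode (f n) ∈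
    Nat.Partrec.Code.eval (Denumerable.ofNat Nat.Partrec.Code i) n := by
  have h : Nat.Partrec fun n => Part.some (Encodable.encode (f n)) :=
    Partrec.nat_iff.1 (Computable.encode.comp hf)
  obtain ⟨c, hc⟩ := Nat.Partrec.Code.exists_code.1 h
  exact ⟨Encodable.encode c, fun n => by simp [hc]⟩

end Computability

theorem runFor_eq_of_eval {α : Type} [Primcodable α] {e n : ℕ} {a : α}
    (h : Encodable.encode a ∈ Nat.Partrec.Code.eval (Denumerable.ofNat Nat.Partrec.Code e) n) :
    (∀ᶠ s in atTop, runFor α s e n = some a) ∧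
      ∀ s, (runFor α s e n).isSome → runFor α s e n = some a := by
  constructor
  · obtain ⟨k, hk⟩ := Nat.Partrec.Code.evaln_complete.1 h
    filter_upwards [eventually_ge_atTop k] with s hs
    have := Nat.Partrec.Code.evaln_mono hs hk
    rw [Option.mem_def] at this
    simp [runFor, this]
  · intro s hs
    unfold runFor at hs ⊢
    cases hk : Nat.Partrec.Code.evaln s (Denumerable.ofNat Nat.Partrec.Code e) n with
    | none => simp [hk] at hs
    | some y =>
      have h1 : y = Encodable.encode a := Part.mem_unique (Nat.Partrec.Code.evaln_sound hk) h
      simp [h1]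

/-! ### Stage costs -/

theorem IsRatComputable.nonneg {cs : ℕ → ℕ → ℚ} (h : IsRatComputable cs) (s x : ℕ) :
    0 ≤ cs s x := by
  obtain ⟨p, q, -, -, h⟩ := h
  rw [(h s x).2]
  positivity

theorem stageCost_nonneg {cs : ℕ → ℕ → ℚ} (h : ∀ s x, 0 ≤ cs s x) (As : ℕ → ℕ → Bool) (s : ℕ) :
    0 ≤ stageCost cs As s := by
  unfold stageCost
  split_ifs
  · exact h _ _
  · exact le_rfl

/-- The total cost of the changes before stage `s`. -/
noncomputable def costBefore (cs : ℕ → ℕ → ℚ) (As : ℕ → ℕ → Bool) (s : ℕ) : ℚ :=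
  ∑ t ∈ Finset.range s, stageCost cs As t

theorem monotone_costBefore {cs : ℕ → ℕ → ℚ} (h : ∀ s x, 0 ≤ cs s x) (As : ℕ → ℕ → Bool) :
    Monotone (costBefore cs As) :=
  monotone_nat_of_le_succ fun s => by
    rw [costBefore, costBefore, Finset.sum_range_succ]
    exact le_add_of_nonneg_right (stageCost_nonneg h As s)

theorem costBefore_nonneg {cs : ℕ → ℕ → ℚ} (h : ∀ s x, 0 ≤ cs s x) (As : ℕ → ℕ → Bool)
    (s : ℕ) : 0 ≤ costBefore cs As s :=
  Finset.sum_nonneg fun t _ => stageCost_nonneg h As t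

/-- A change below `x` between the stages `u` and `v` costs at least `cs u x`. -/
theorem cost_le_of_change {cs : ℕ → ℕ → ℚ} (h0 : ∀ s x, 0 ≤ cs s x)
    (ha : ∀ s, Antitone (cs s)) (hm : ∀ x, Monotone fun s => cs s x) {As : ℕ → ℕ → Bool}
    {u v x y : ℕ} (huv : u ≤ v) (hyx : y ≤ x) (hne : As u y ≠ As v y) :
    cs u x + costBefore cs As u ≤ costBefore cs As v := by
  obtain ⟨w, hw, hwv, hch⟩ : ∃ w, u ≤ w ∧ w < v ∧ As w y ≠ As (w + 1) y := by
    by_contra! hc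
    apply hne
    obtain ⟨k, rfl⟩ := Nat.exists_eq_add_of_le huv
    have : ∀ j ≤ k, As u y = As (u + j) y := by
      intro j hj
      induction j with
      | zero => rfl
      | succ j ih => rw [ih (by omega), hc (u + j) (by omega) (by omega)]; rfl
    exact this k le_rfl
  have h1 : cs u x ≤ stageCost cs As w := by
    have hex : ∃ z, As w z ≠ As (w + 1) z := ⟨y, hch⟩
    rw [stageCost, dif_pos hex]
    exact (hm x (by omega : u ≤ w + 1)).trans (ha _ ((Nat.find_min' hex hch).trans hyx))
  have h2 := monotone_costBefore h0 As hw
  have h3 := monotone_costBefore h0 As (show w + 1 ≤ v from hwv)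
  have h4 : costBefore cs As (w + 1) = costBefore cs As w + stageCost cs As w :=
    Finset.sum_range_succ _ _
  linarith

theorem costBefore_le_tsum {cs : ℕ → ℕ → ℚ} (h0 : ∀ s x, 0 ≤ cs s x) {As : ℕ → ℕ → Bool}
    (hs : Summable fun s => (stageCost cs As s : ℝ)) (u : ℕ) :
    (costBefore cs As u : ℝ) ≤ ∑' s, (stageCost cs As s : ℝ) := by
  rw [costBefore, Rat.cast_sum]
  exact hs.sum_le_tsum _ fun s _ => by exact_mod_cast stageCost_nonneg h0 As s

/-! ### Change sets -/

open Classical in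
/-- The number of changes at `x` before stage `F`. -/
noncomputable def changes (Bs : ℕ → ℕ → Bool) (x F : ℕ) : ℕ :=
  Nat.count (fun k => Bs (k + 1) x ≠ Bs k x) F

theorem monotone_changes (Bs : ℕ → ℕ → Bool) (x : ℕ) : Monotone (changes Bs x) :=
  Nat.count_monotone _

theorem computable_changes {Bs : ℕ → ℕ → Bool} (h : Computable₂ Bs) :
    Computable₂ (changes Bs) :=
  (computable_count (R := fun x k => Bs (k + 1) x ≠ Bs k x)
    (computablePred_ne (h.comp (Computable.succ.comp Computable.snd) Computable.fst)
      (h.comp Computable.snd Computable.fst))).of_eq fun q => by unfold changes; congr!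

theorem mem_changeSet {Bs : ℕ → ℕ → Bool} {w : ℕ} :
    w ∈ changeSet Bs ↔ ∃ F, w.unpair.2 ≤ changes Bs w.unpair.1 F := by
  classical
  constructor
  · rintro ⟨x, n, rfl, S, rfl, hS⟩
    refine ⟨S.sup id + 1, ?_⟩
    rw [Nat.unpair_pair, changes, Nat.count_eq_card_filter_range]
    refine Finset.card_le_card fun s hs => ?_
    rw [Finset.mem_filter, Finset.mem_range]
    exact ⟨Nat.lt_succ_of_le (Finset.le_sup (f := id) hs), hS s hs⟩
  · rintro ⟨F, hF⟩
    rw [changes, Nat.count_eq_card_filter_range] at hF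
    obtain ⟨S, hS, hc⟩ := Finset.exists_subset_card_eq hF
    exact ⟨_, _, (Nat.pair_unpair w).symm, S, hc, fun s hs => (Finset.mem_filter.1 (hS hs)).2⟩

theorem isCE_changeSet {Bs : ℕ → ℕ → Bool} (h : Computable₂ Bs) : IsCE (changeSet Bs) := by
  refine (rePred_exists (R := fun w F => w.unpair.2 ≤ changes Bs w.unpair.1 F) ?_).of_eq
    fun w => mem_changeSet.symm
  exact computablePred_le (Computable.snd.comp (Computable.unpair.comp Computable.fst))
    ((computable_changes h).comp (Computable.fst.comp (Computable.unpair.comp Computable.fst))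
      Computable.snd)

theorem value_eq_xor_bodd (Bs : ℕ → ℕ → Bool) (x F : ℕ) :
    Bs F x = xor (Bs 0 x) (changes Bs x F).bodd := by
  classical
  induction F with
  | zero => simp [changes]
  | succ F ih =>
    have : changes Bs x (F + 1) = changes Bs x F + if Bs (F + 1) x ≠ Bs F x then 1 else 0 := by
      simp only [changes, Nat.count_succ]
    rw [this]
    by_cases h : Bs (F + 1) x = Bs F x
    · simp [h, ih]
    · simp only [ne_eq, h, not_false_eq_true, if_true, Nat.bodd_add, Nat.bodd_one]
      rw [Bool.eq_not_of_ne h, ih]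
      cases Bs 0 x <;> cases (changes Bs x F).bodd <;> rfl

theorem exists_last_change {Bs : ℕ → ℕ → Bool} {A : Set ℕ} (h : IsComputableApprox Bs A) (x : ℕ) :
    ∃ F, (∀ G, changes Bs x G ≤ changes Bs x F) ∧ (Bs F x = true ↔ x ∈ A) := by
  classical
  obtain ⟨F, hF⟩ := eventually_atTop.1 (h.eventually_eq x)
  have hc : ∀ G ≥ F, Bs G x = Bs F x := fun G hG => by
    rw [Bool.eq_iff_iff, hF G hG, hF F le_rfl]
  refine ⟨F, fun G => ?_, hF F le_rfl⟩
  rcases le_total G F with hG | hG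
  · exact monotone_changes Bs x hG
  · induction G, hG using Nat.le_induction with
    | base => exact le_rfl
    | succ G hG ih =>
      have : changes Bs x (G + 1) = changes Bs x G := by
        simp only [changes, Nat.count_succ]
        simp [hc G hG, hc (G + 1) (by omega)]
      rw [this]; exact ih

/-- The total number of changes at `x` is the first `n` with `Nat.pair x (n + 1)` outside the
oracle. Its parity and `Bs 0 x` determine the limit value. -/
theorem computes_changeSet {Bs : ℕ → ℕ → Bool} {A : Set ℕ} (h : IsComputableApprox Bs A) :
    Computes (changeSet Bs) A := by
  classical
  choose F hF using exists_last_change h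
  have hmem : ∀ x n, Nat.pair x n ∈ changeSet Bs ↔ n ≤ changes Bs x (F x) := fun x n => by
    rw [mem_changeSet, Nat.unpair_pair]
    exact ⟨fun ⟨G, hG⟩ => hG.trans ((hF x).1 G), fun h => ⟨_, h⟩⟩
  rw [Computes, TuringReducible, RecursiveIn.iff_nat]
  have h1 : Nat.RecursiveIn {charFun (changeSet Bs)} fun z : ℕ =>
      charFun (changeSet Bs) (Nat.pair z.unpair.1 (z.unpair.2 + 1)) := by
    refine (Nat.RecursiveIn.comp (Nat.RecursiveIn.oracle _ (Set.mem_singleton _)) (Nat.Partrec.recursiveIn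
      (Partrec.nat_iff.1 (Primrec.to_comp (Primrec₂.natPair.comp
      (Primrec.fst.comp Primrec.unpair) (Primrec.succ.comp
        (Primrec.snd.comp Primrec.unpair)))).partrec))).of_eq fun z => Part.bind_some _ _
  have h3 : ∀ x, (Nat.rfind fun n => (fun m => (m = 0 : Bool)) <$>
      charFun (changeSet Bs) (Nat.pair (Nat.pair x n).unpair.1 ((Nat.pair x n).unpair.2 + 1))) =
        Part.some (changes Bs x (F x)) := by
    intro x
    refine Part.eq_some_iff.2 (Nat.mem_rfind.2 ⟨?_, ?_⟩)
    · simp [charFun, hmem]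
    · intro m hm
      have : m + 1 ≤ changes Bs x (F x) := hm
      simp [charFun, hmem, this]
  have h2 : Nat.RecursiveIn {charFun (changeSet Bs)} fun x => Part.some (changes Bs x (F x)) :=
    (Nat.RecursiveIn.rfind h1).of_eq h3
  have h4 : Nat.RecursiveIn {charFun (changeSet Bs)}
      fun x => Part.some (Nat.pair x (changes Bs x (F x))) :=
    (Nat.RecursiveIn.pair (Nat.Partrec.recursiveIn
      (Partrec.nat_iff.1 (Computable.id.partrec : Partrec fun n : ℕ => Part.some n))) h2).of_eq
      fun x => by simp [Seq.seq]
  have h5 : Computable fun z : ℕ => (xor (Bs 0 z.unpair.1) z.unpair.2.bodd).toNat :=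
    (Primrec.dom_bool Bool.toNat).to_comp.comp ((Primrec.dom_bool₂ xor).to_comp.comp
      (h.computable.comp (Computable.const 0) (Computable.fst.comp Computable.unpair))
      (Computable.nat_bodd.comp (Computable.snd.comp Computable.unpair)))
  refine (Nat.RecursiveIn.comp (Nat.Partrec.recursiveIn (Partrec.nat_iff.1 h5.partrec)) h4).of_eq
    fun x => (Part.bind_some _ _).trans ?_
  have h6 := (hF x).2
  rw [value_eq_xor_bodd Bs x (F x)] at h6
  simp only [charFun, ← h6, PFun.coe_val, Nat.unpair_pair]
  cases Bs 0 x <;> cases (changes Bs x (F x)).bodd <;> simp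

/-! ### Requirements with total streams -/

theorem runFor_mono {α : Type} [Primcodable α] {s t e n : ℕ} {a : α} (hst : s ≤ t)
    (h : runFor α s e n = some a) : runFor α t e n = some a := by
  unfold runFor at h ⊢
  obtain ⟨y, hy, hd⟩ := Option.bind_eq_some_iff.1 h
  rw [Option.mem_def.1 (Nat.Partrec.Code.evaln_mono hst (Option.mem_def.2 hy))]
  exact hd

/-- `i` is an index for the initial segments of the approximation `As`. -/
def IsSetIndex (i : ℕ) (As : ℕ → ℕ → Bool) : Prop :=
  ∀ u, Encodable.encode ((List.range u).map (As u)) ∈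
    Nat.Partrec.Code.eval (Denumerable.ofNat Nat.Partrec.Code i) u

/-- `e` is an index for the initial segments of an approximation `Bs` together with costs which
are given by numerators and denominators. -/
def IsCostIndex (e : ℕ) (Bs : ℕ → ℕ → Bool) (p q : ℕ → ℕ → ℕ) : Prop :=
  ∀ v, Encodable.encode ((List.range v).map fun x => (Bs v x, p v x, q v x)) ∈
    Nat.Partrec.Code.eval (Denumerable.ofNat Nat.Partrec.Code e) v

section SetIndex

variable {i : ℕ} {As : ℕ → ℕ → Bool} (hi : IsSetIndex i As)

include hi

theorem IsSetIndex.setAt_eq {s u : ℕ} (hs : (runFor (List Bool) s i u).isSome) :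
    setAt s i u = (List.range u).map (As u) := by
  rw [setAt, (runFor_eq_of_eval (hi u)).2 s hs, Option.getD_some]

theorem IsSetIndex.setAt_of_acts {s : ℕ} (hs : Acts s) (hsi : s.unpair.1 = i) :
    setAt s i (inspected s i) = (List.range (inspected s i)).map (As (inspected s i)) := by
  subst hsi
  exact hi.setAt_eq hs

/-- Without further action the inspected stage would stay fixed. Its computation halts within some
number of steps, and arbitrarily large stages belong to the stream. -/
theorem IsSetIndex.exists_acts (N : ℕ) : ∃ s ≥ N, Acts s ∧ s.unpair.1 = i := by
  by_contra! hc
  have h1 : ∀ s ≥ N, inspected s i = inspected N i := by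
    intro s hs
    induction s, hs using Nat.le_induction with
    | base => rfl
    | succ s hs ih => rw [inspected_succ_of_ne fun h => hc s hs h.1 h.2, ih]
  obtain ⟨M, hM⟩ := eventually_atTop.1 (runFor_eq_of_eval (hi (inspected N i))).1
  have h2 : M + N ≤ Nat.pair i (M + N) := Nat.right_le_pair _ _
  refine hc (Nat.pair i (M + N)) (by omega) ?_ (by simp)
  have h3 : query (history (Nat.pair i (M + N))) i = inspected N i := h1 _ (by omega)
  rw [Acts, Nat.unpair_pair, h3, hM _ (by omega)]
  rfl

theorem IsSetIndex.tendsto_inspected : Tendsto (fun s => inspected s i) atTop atTop := by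
  refine tendsto_atTop_atTop_of_monotone (monotone_inspected i) fun b => ?_
  obtain ⟨s, hs, ha, hsi⟩ := hi.exists_acts b
  exact ⟨s + 1, hs.trans (lt_inspected ha hsi (Nat.lt_succ_self s)).le⟩

/-- Without confirmations the targets are frozen, so from stage `N` on only numbers below `N` are
lowered. Each action then strictly decreases the sum `Φ` of their levels, which cannot go on
forever. -/
theorem IsSetIndex.exists_confirms (N : ℕ) : ∃ s ≥ N, Confirms s ∧ s.unpair.1 = i := by
  by_contra! hc
  have h1 : ∀ r, r.unpair.1 = i → ∀ s ≥ N, stageTarget s r = stageTarget N r := by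
    intro r hr s hs
    induction s, hs using Nat.le_induction with
    | base => rfl
    | succ s hs ih =>
      rw [stageTarget_succ_of_not fun h => hc s hs h.1.1 (h.1.2.1.trans hr), ih]
  let Φ : ℕ → ℕ := fun s => ∑ x ∈ Finset.range N, stageLevel (inspected s i) x
  have hΦ : Antitone Φ := fun s t hst =>
    Finset.sum_le_sum fun x _ => antitone_stageLevel x (monotone_inspected i hst)
  obtain ⟨M, hM⟩ := Nat.sInf_mem (Set.range_nonempty Φ)
  obtain ⟨s, hs, ha, hsi⟩ := hi.exists_acts (M + N)
  have hl : Lowers s := ⟨ha, fun h => hc s (by omega) ⟨ha, h⟩ hsi⟩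
  have h2 : stageArg s < N := by
    have h3 := stageArg_lt hl
    rw [h1 (stageReq s) ((stageReq_unpair hl).trans hsi) s (by omega)] at h3
    exact h3.trans_le (stageTarget_fst_le _ _)
  have h4 : stageLevel (inspected (s + 1) i) (stageArg s) <
      stageLevel (inspected s i) (stageArg s) := by
    have h5 := newLevel_add_one hl
    have h6 : stageLevel (s + 1) (stageArg s) ≤ newLevel s := by
      rw [stageLevel_succ_of_lowers hl le_rfl]; exact min_le_left _ _
    have h7 := inspected_succ_self ha
    rw [hsi] at h5 h7
    rw [h7]
    omega
  have h5 : Φ (s + 1) < Φ s := Finset.sum_lt_sum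
    (fun x _ => antitone_stageLevel x (monotone_inspected i (Nat.le_succ s)))
    ⟨_, Finset.mem_range.2 h2, h4⟩
  have h6 : Φ s ≤ Φ M := hΦ (by omega)
  have h7 : sInf (Set.range Φ) ≤ Φ (s + 1) := Nat.sInf_le ⟨_, rfl⟩
  omega

end SetIndex

section Requirement

variable {r : ℕ} {As Bs : ℕ → ℕ → Bool} {p q : ℕ → ℕ → ℕ}
  (hi : IsSetIndex r.unpair.1 As) (he : IsCostIndex r.unpair.2.unpair.1 Bs p q)

include he in
theorem IsCostIndex.costSetAt_eq {s v : ℕ} (hs : 0 < (costSetAt s r.unpair.2.unpair.1 v).length) :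
    runFor (List (Bool × ℕ × ℕ)) s r.unpair.2.unpair.1 v =
      some ((List.range v).map fun x => (Bs v x, p v x, q v x)) := by
  refine (runFor_eq_of_eval (he v)).2 s ?_
  by_contra h
  rw [Option.not_isSome_iff_eq_none] at h
  simp [costSetAt, h] at hs

include hi in
-- The inspected list has length `inspected s r.unpair.1`, so comparisons below the number of
-- targets never read a default entry.
theorem IsSetIndex.target_le (s : ℕ) : (stageTarget s r).1 ≤ inspected s r.unpair.1 := by
  induction s with
  | zero => simp [stageTarget_zero]
  | succ s ih =>
    by_cases h : Advances s r
    · have h1 := h.isNextTarget.2.1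
      rw [hi.setAt_of_acts h.1.1.1 h.1.2.1, List.length_map, List.length_range] at h1
      have h2 := monotone_inspected r.unpair.1 (Nat.le_succ s)
      rw [stageTarget_succ_of_advances h]
      exact le_trans h1 h2
    · rw [stageTarget_succ_of_not h]
      exact ih.trans (monotone_inspected r.unpair.1 (Nat.le_succ s))

include he in
theorem IsCostIndex.target_spec (s : ℕ) (hs : 0 < (stageTarget s r).1) :
    (stageTarget s r).1 ≤ (stageTarget s r).2 ∧
    runFor (List (Bool × ℕ × ℕ)) s r.unpair.2.unpair.1 (stageTarget s r).2 =
      some ((List.range (stageTarget s r).2).map fun x =>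
        (Bs (stageTarget s r).2 x, p (stageTarget s r).2 x, q (stageTarget s r).2 x)) := by
  induction s with
  | zero => simp [stageTarget_zero] at hs
  | succ s ih =>
    by_cases h : Advances s r
    · have h1 := h.isNextTarget.2.2.1
      have h2 := he.costSetAt_eq (Nat.zero_lt_of_lt h1)
      rw [costSetAt, h2, Option.getD_some, List.length_map, List.length_range] at h1
      refine ⟨?_, runFor_mono (Nat.le_succ s) h2⟩
      have h3 : (stageTarget (s + 1) r).1 = (stageTarget s r).1 + 1 := by
        rw [stageTarget_succ_of_advances h]
      rw [h3]
      exact h1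
    · rw [stageTarget_succ_of_not h] at hs ⊢
      exact ⟨(ih hs).1, runFor_mono (Nat.le_succ s) (ih hs).2⟩

theorem getD_map_range {α : Type*} (f : ℕ → α) (d : α) {n x : ℕ} (h : x < n) :
    ((List.range n).map f).getD x d = f x := by
  simp [List.getD, h]

include hi in
theorem IsSetIndex.getD_setAt {s x : ℕ} (hs : Acts s) (hsi : s.unpair.1 = r.unpair.1)
    (hx : x < (stageTarget s r).1) :
    (setAt s s.unpair.1 (inspected s s.unpair.1)).getD x false =
      As (inspected s r.unpair.1) x := by
  rw [hsi, hi.setAt_of_acts hs hsi, getD_map_range _ _ (hx.trans_le (hi.target_le s))]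

include he in
theorem IsCostIndex.getD_costSetAt {s x : ℕ} (hx : x < (stageTarget s r).1) :
    (costSetAt s r.unpair.2.unpair.1 (stageTarget s r).2).getD x (false, 0, 0) =
      (Bs (stageTarget s r).2 x, p (stageTarget s r).2 x, q (stageTarget s r).2 x) := by
  have h := he.target_spec s (Nat.zero_lt_of_lt hx)
  rw [costSetAt, h.2, Option.getD_some, getD_map_range _ _ (hx.trans_le h.1)]

include hi he in
theorem agreeBelow_iff {s x : ℕ} (hs : Acts s) (hsi : s.unpair.1 = r.unpair.1)
    (hx : x ≤ (stageTarget s r).1) :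
    AgreeBelow (setAt s s.unpair.1 (inspected s s.unpair.1))
      (costSetAt s r.unpair.2.unpair.1 (stageTarget s r).2) x ↔
      ∀ y < x, As (inspected s r.unpair.1) y = Bs (stageTarget s r).2 y := by
  refine forall₂_congr fun y hy => ?_
  rw [hi.getD_setAt hs hsi (hy.trans_le hx), he.getD_costSetAt (hy.trans_le hx)]

include hi he in
theorem lowers_spec {s : ℕ} (hs : Lowers s) (hr : stageReq s = r) :
    (∀ y < stageArg s, As (inspected s r.unpair.1) y = Bs (stageTarget s r).2 y) ∧
    As (inspected s r.unpair.1) (stageArg s) ≠ Bs (stageTarget s r).2 (stageArg s) ∧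
    q (stageTarget s r).2 (stageArg s) <
      p (stageTarget s r).2 (stageArg s) * 2 ^ (newLevel s + 1) := by
  have h := asks_of_lowers hs
  have hx := stageArg_lt hs
  have hsi := (stageReq_unpair hs).symm
  rw [newLevel_add_one hs]
  have h1 : (stageChoice s - 1).unpair.1 = r := hr
  have h2 : (stageChoice s - 1).unpair.2 = stageArg s := rfl
  rw [hr] at hx hsi
  simp only [Asks, h1, h2] at h
  obtain ⟨-, -, h3, h4, -, h5, -⟩ := h
  have h6 : target (history s) r = stageTarget s r := rfl
  rw [h6] at h3 h4 h5
  rw [hi.getD_setAt hs.1 hsi hx, he.getD_costSetAt hx] at h4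
  rw [he.getD_costSetAt hx, level_history_eq (inspected_le s _)] at h5
  exact ⟨(agreeBelow_iff hi he hs.1 hsi hx.le).1 h3, h4, h5⟩

include hi he in
theorem confirms_spec {s x : ℕ} (hs : Confirms s) (hsi : s.unpair.1 = r.unpair.1)
    (hx : x < (stageTarget s r).1)
    (h1 : ∀ y < x, As (inspected s r.unpair.1) y = Bs (stageTarget s r).2 y)
    (h2 : As (inspected s r.unpair.1) x ≠ Bs (stageTarget s r).2 x)
    (h3 : ∀ m, (lowerings s r m).card < r.unpair.2.unpair.2 * 2 ^ m) :
    stageLevel (inspected s r.unpair.1) x ≤ r ∨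
      p (stageTarget s r).2 x * 2 ^ stageLevel (inspected s r.unpair.1) x ≤
        q (stageTarget s r).2 x := by
  by_contra! hc
  apply not_asks_of_confirms (w := Nat.pair r x) hs
  simp only [Asks, Nat.unpair_pair]
  have h6 : target (history s) r = stageTarget s r := rfl
  rw [h6, (agreeBelow_iff hi he hs.1 hsi hx.le), hi.getD_setAt hs.1 hsi hx, he.getD_costSetAt hx,
    level_history_eq (inspected_le s _), lowerCount_eq_card]
  refine ⟨hsi.symm, hx, h1, h2, ?_, ?_, h3 _⟩
  · rw [hsi]; exact hc.1
  · rw [hsi]; exact hc.2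

include hi he in
theorem advances_spec {s : ℕ} (hs : Advances s r) :
    ∀ y < (stageTarget (s + 1) r).1,
      As (inspected s r.unpair.1) y = Bs (stageTarget (s + 1) r).2 y := by
  have h3 : (stageTarget (s + 1) r).1 = (stageTarget s r).1 + 1 := by
    rw [stageTarget_succ_of_advances hs]
  have h := hs.isNextTarget
  have h1 := h.2.2.1
  have h2 := he.costSetAt_eq (Nat.zero_lt_of_lt h1)
  have h4 := h.2.1
  intro y hy
  have h5 := h.2.2.2 y (by omega)
  rw [hi.setAt_of_acts hs.1.1.1 hs.1.2.1] at h4 h5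
  rw [costSetAt, h2, Option.getD_some] at h1 h5
  rw [List.length_map, List.length_range] at h1 h4
  rwa [getD_map_range _ _ (by omega), getD_map_range _ _ (by omega)] at h5

include hi he in
-- Both approximations converge to `A` on the initial segment that a frozen target would require. A
-- late enough `V` therefore qualifies as next target at every late confirmation.
theorem exists_advances {A : Set ℕ} (hA : IsComputableApprox As A) (hB : IsComputableApprox Bs A)
    (N : ℕ) : ∃ s ≥ N, Advances s r := by
  by_contra! hc
  have h1 : ∀ s ≥ N, stageTarget s r = stageTarget N r := by
    intro s hs
    induction s, hs using Nat.le_induction with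
    | base => rfl
    | succ s hs ih => rw [stageTarget_succ_of_not (hc s hs), ih]
  have hall : ∀ {Cs : ℕ → ℕ → Bool}, IsComputableApprox Cs A → ∀ j,
      ∀ᶠ s in atTop, ∀ y ∈ Finset.range j, (Cs s y = true ↔ y ∈ A) := fun hC j =>
    (eventually_all_finset _).2 fun y _ => hC.eventually_eq y
  obtain ⟨V, hV, hVj, hVt⟩ := ((hall hB ((stageTarget N r).1 + 1)).and
    ((eventually_gt_atTop (stageTarget N r).1).and
      (eventually_gt_atTop (stageTarget N r).2))).exists
  have h2 := ((hi.tendsto_inspected.eventually ((hall hA ((stageTarget N r).1 + 1)).and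
    (eventually_gt_atTop (stageTarget N r).1))).and
      ((runFor_eq_of_eval (he V)).1)).and ((eventually_ge_atTop V).and
        ((eventually_gt_atTop r).and (eventually_ge_atTop N)))
  obtain ⟨M, hM⟩ := eventually_atTop.1 h2
  obtain ⟨s, hs, hcs, hsi⟩ := hi.exists_confirms M
  obtain ⟨⟨⟨h3, h4⟩, h5⟩, h6, h7, h8⟩ := hM s hs
  refine hc s h8 ⟨⟨hcs, hsi, h7⟩, nextTarget_ne_zero h6 ?_⟩
  rw [h1 s h8, hsi]
  have h9 : costSetAt s r.unpair.2.unpair.1 V =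
    (List.range V).map fun x => (Bs V x, p V x, q V x) := by rw [costSetAt, h5, Option.getD_some]
  rw [IsNextTarget, hi.setAt_of_acts hcs.1 hsi, h9]
  refine ⟨hVt, by simpa using h4, by simpa using hVj, fun y hy => ?_⟩
  rw [getD_map_range _ _ (by omega), getD_map_range _ _ (by omega), Bool.eq_iff_iff,
    h3 y (by simpa using hy), hV y (by simpa using hy)]

/-! ### The number of lowerings -/

variable {ds : ℕ → ℕ → ℚ} {d : ℕ → ℝ} (hpq : ∀ v x, 0 < q v x ∧ ds v x = (p v x : ℚ) / q v x)
  (hd : IsMonotoneApprox ds d)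

include hi he hpq hd in
-- By induction along the lowerings of `r` to level `m`: each one is paid for, by `As` or by `Bs`,
-- before the next one occurs.
theorem card_lowerings_le_cost {s m : ℕ} (hs : Lowers s) (hr : stageReq s = r)
    (hm : newLevel s = m) :
    ((lowerings s r m).card : ℚ) * (1 / 2 ^ (m + 1)) ≤
      costBefore stageCostFun As (inspected s r.unpair.1) +
        costBefore ds Bs (stageTarget s r).2 := by
  have h0 : ∀ s x, 0 ≤ stageCostFun s x := fun s x => (stageCostFun_pos s x).le
  have hd0 := hd.computable.nonneg
  induction s using Nat.strong_induction_on with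
  | _ s ih =>
  rcases (lowerings s r m).eq_empty_or_nonempty with hemp | hne
  · rw [hemp]
    simpa using add_nonneg (costBefore_nonneg h0 As (inspected s r.unpair.1))
      (costBefore_nonneg hd0 Bs (stageTarget s r).2)
  · let t := (lowerings s r m).max' hne
    obtain ⟨hts, htl, htr, htm⟩ := mem_lowerings.1 ((lowerings s r m).max'_mem hne)
    have hcard : lowerings s r m ⊆ insert t (lowerings t r m) := by
      intro z hz
      rcases ((lowerings s r m).le_max' z hz).eq_or_lt with h | h
      · rw [h]; exact Finset.mem_insert_self _ _
      · exact Finset.mem_insert_of_mem (mem_lowerings.2 ⟨h, (mem_lowerings.1 hz).2⟩)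
    have hcard' : (lowerings s r m).card ≤ (lowerings t r m).card + 1 :=
      (Finset.card_le_card hcard).trans (Finset.card_insert_le _ _)
    have hcard'' : ((lowerings s r m).card : ℚ) ≤ (lowerings t r m).card + 1 := by
      exact_mod_cast hcard'
    have iht := ih t hts htl htr htm
    obtain ⟨-, ht2, ht3⟩ := lowers_spec hi he htl htr
    obtain ⟨hs1, -, -⟩ := lowers_spec hi he hs hr
    have hti : t.unpair.1 = r.unpair.1 := by rw [← htr]; exact (stageReq_unpair htl).symm
    have hsi : s.unpair.1 = r.unpair.1 := by rw [← hr]; exact (stageReq_unpair hs).symm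
    have huv : inspected t r.unpair.1 ≤ inspected s r.unpair.1 :=
      monotone_inspected _ hts.le
    have hvv : (stageTarget t r).2 ≤ (stageTarget s r).2 := monotone_stageTarget_snd r hts.le
    -- After stage `t` all numbers up to `stageArg t` have level at most `m`, whereas the number
    -- lowered at `s` still has level `m + 1`.
    have hxlt : stageArg t < stageArg s := by
      by_contra hx
      have h1 := newLevel_add_one hs
      have h2 : stageLevel (inspected s s.unpair.1) (stageArg s) ≤ newLevel t := by
        rw [hsi]
        calc stageLevel (inspected s r.unpair.1) (stageArg s)
            ≤ stageLevel (t + 1) (stageArg s) :=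
              antitone_stageLevel _ (lt_inspected htl.1 hti hts)
          _ ≤ stageLevel (t + 1) (stageArg t) := monotone_stageLevel _ (not_lt.1 hx)
          _ ≤ newLevel t := by
            rw [stageLevel_succ_of_lowers htl le_rfl]; exact min_le_left _ _
      rw [← h1, hm] at h2
      have : newLevel t = m := htm
      omega
    have hA := monotone_costBefore h0 As huv
    have hB := monotone_costBefore hd0 Bs hvv
    have hpay : costBefore stageCostFun As (inspected t r.unpair.1) +
        costBefore ds Bs (stageTarget t r).2 + 1 / 2 ^ (m + 1) ≤
        costBefore stageCostFun As (inspected s r.unpair.1) +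
        costBefore ds Bs (stageTarget s r).2 := by
      -- At `t` the set and the target differ at `stageArg t`. At `s` they agree there, since their
      -- first difference is the larger `stageArg s`. So one of the two has changed.
      by_cases hch : As (inspected t r.unpair.1) (stageArg t) =
          As (inspected s r.unpair.1) (stageArg t)
      · have h1 : Bs (stageTarget t r).2 (stageArg t) ≠ Bs (stageTarget s r).2 (stageArg t) := by
          rw [← hs1 _ hxlt, ← hch]; exact fun h => ht2 h.symm
        have h2 := cost_le_of_change hd0 hd.antitone hd.monotone hvv le_rfl h1
        have h3 : (1 : ℚ) / 2 ^ (m + 1) ≤ ds (stageTarget t r).2 (stageArg t) := by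
          have h4 : newLevel t = m := htm
          rw [h4] at ht3
          obtain ⟨hq, hdq⟩ := hpq (stageTarget t r).2 (stageArg t)
          rw [hdq, div_le_div_iff₀ (by positivity) (by exact_mod_cast hq), one_mul]
          exact_mod_cast ht3.le
        linarith
      · have h2 := cost_le_of_change h0 antitone_stageCostFun monotone_stageCostFun huv le_rfl hch
        have h3 : (1 : ℚ) / 2 ^ (m + 1) = stageCostFun (inspected t r.unpair.1) (stageArg t) := by
          have h4 : newLevel t = m := htm
          rw [stageCostFun, ← hti, ← newLevel_add_one htl, h4]
        linarith
    have hpos : (0 : ℚ) < 1 / 2 ^ (m + 1) := by positivity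
    nlinarith

include hi he hpq hd in
-- The summand 1 in `hK` covers the latest lowering, which need not be paid for yet. The factor 2
-- turns the payments `1 / 2 ^ (m + 1)` into a bound in terms of `2 ^ m`.
theorem card_lowerings_lt (hA : Summable fun s => (stageCost stageCostFun As s : ℝ))
    (hB : Summable fun s => (stageCost ds Bs s : ℝ))
    (hK : 1 + 2 * (∑' s, (stageCost stageCostFun As s : ℝ) + ∑' s, (stageCost ds Bs s : ℝ)) <
      r.unpair.2.unpair.2) (s m : ℕ) :
    (lowerings s r m).card < r.unpair.2.unpair.2 * 2 ^ m := by
  have h0 : ∀ s x, 0 ≤ stageCostFun s x := fun s x => (stageCostFun_pos s x).le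
  have hd0 := hd.computable.nonneg
  have hA0 : 0 ≤ ∑' s, (stageCost stageCostFun As s : ℝ) :=
    tsum_nonneg fun s => by exact_mod_cast stageCost_nonneg h0 As s
  have hB0 : 0 ≤ ∑' s, (stageCost ds Bs s : ℝ) :=
    tsum_nonneg fun s => by exact_mod_cast stageCost_nonneg hd0 Bs s
  have hKpos : 0 < r.unpair.2.unpair.2 := by
    have : (0 : ℝ) < r.unpair.2.unpair.2 := by linarith
    exact_mod_cast this
  rcases (lowerings s r m).eq_empty_or_nonempty with hemp | hne
  · rw [hemp]; simpa using hKpos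
  · obtain ⟨hts, htl, htr, htm⟩ := mem_lowerings.1 ((lowerings s r m).max'_mem hne)
    have hcard : lowerings s r m ⊆ insert ((lowerings s r m).max' hne)
        (lowerings ((lowerings s r m).max' hne) r m) := by
      intro z hz
      rcases ((lowerings s r m).le_max' z hz).eq_or_lt with h | h
      · rw [h]; exact Finset.mem_insert_self _ _
      · exact Finset.mem_insert_of_mem (mem_lowerings.2 ⟨h, (mem_lowerings.1 hz).2⟩)
    have hcard' := (Finset.card_le_card hcard).trans (Finset.card_insert_le _ _)
    have h1 := card_lowerings_le_cost hi he hpq hd htl htr htm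
    generalize (lowerings s r m).max' hne = t at *
    have h2 := costBefore_le_tsum h0 hA (inspected t r.unpair.1)
    have h3 := costBefore_le_tsum hd0 hB (stageTarget t r).2
    have h4 : ((lowerings t r m).card : ℝ) * (1 / 2 ^ (m + 1)) ≤
      (costBefore stageCostFun As (inspected t r.unpair.1) : ℝ) +
        (costBefore ds Bs (stageTarget t r).2 : ℝ) := by
      have := (Rat.cast_le (K := ℝ)).2 h1
      push_cast at this
      exact this
    have h5 : ((lowerings s r m).card : ℝ) ≤ (lowerings t r m).card + 1 := by
      exact_mod_cast hcard'
    have h6 : (1 : ℝ) ≤ 2 ^ m := one_le_pow₀ (by norm_num)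
    have h7 : ((lowerings t r m).card : ℝ) ≤ (∑' s, (stageCost stageCostFun As s : ℝ) +
        ∑' s, (stageCost ds Bs s : ℝ)) * (2 * 2 ^ m) := by
      have h8 := h4.trans (add_le_add h2 h3)
      rw [mul_one_div, div_le_iff₀ (by positivity), pow_succ, mul_comm ((2 : ℝ) ^ m)] at h8
      exact h8
    have h9 : ((lowerings s r m).card : ℝ) < r.unpair.2.unpair.2 * 2 ^ m := by
      have := mul_lt_mul_of_pos_right hK (by positivity : (0 : ℝ) < 2 ^ m)
      nlinarith
    exact_mod_cast h9

end Requirement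

/-! ### Speeding up an approximation -/

theorem summable_of_le_sub {a g : ℕ → ℝ} {C : ℝ} (h0 : ∀ n, 0 ≤ a n)
    (h : ∀ n, a n ≤ g (n + 1) - g n) (hC : ∀ n, g n ≤ C) : Summable a := by
  refine summable_of_sum_range_le (c := C - g 0) h0 fun n => ?_
  calc ∑ i ∈ Finset.range n, a i ≤ ∑ i ∈ Finset.range n, (g (i + 1) - g i) :=
        Finset.sum_le_sum fun i _ => h i
    _ = g n - g 0 := Finset.sum_range_sub g n
    _ ≤ C - g 0 := by linarith [hC n]

theorem IsComputableApprox.comp {As : ℕ → ℕ → Bool} {A : Set ℕ} (h : IsComputableApprox As A)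
    {f : ℕ → ℕ} (hf : Computable f) (hmono : StrictMono f) :
    IsComputableApprox (fun s => As (f s)) A where
  computable := h.computable.comp (hf.comp Computable.fst) Computable.snd
  eventually_eq x := hmono.tendsto_atTop.eventually (h.eventually_eq x)

/-- Obedience may be witnessed by another approximation `cs` of `costFun`. Passing to stages `f s`
at which `cs` has reached half of the canonical cost at stage `s + 1`, for all `x ≤ s`, at most
doubles the costs of changes there. -/
theorem exists_speedup {A : Set ℕ} (h : Obeys A costFun) :
    ∃ As, IsComputableApprox As A ∧ Summable fun s => (stageCost stageCostFun As s : ℝ) := by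
  classical
  obtain ⟨As, cs, hA, hc, hsum⟩ := h
  obtain ⟨p, q, hp, hq, hpq⟩ := hc.computable
  have h0 := hc.computable.nonneg
  have hR : ComputablePred fun z : ℕ × ℕ =>
      ∀ x < z.1 + 1, q z.2 x ≤ 2 * p z.2 x * 2 ^ stageLevel (z.1 + 1) x := by
    have h1 : ComputablePred fun z : (ℕ × ℕ) × ℕ =>
        q z.1.2 z.2 ≤ 2 * p z.1.2 z.2 * 2 ^ stageLevel (z.1.1 + 1) z.2 :=
      computablePred_le (hq.comp (Computable.snd.comp Computable.fst) Computable.snd)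
        (Primrec.nat_mul.to_comp.comp (Primrec.nat_mul.to_comp.comp (Computable.const 2)
          (hp.comp (Computable.snd.comp Computable.fst) Computable.snd))
          (primrec_two_pow.to_comp.comp (primrec_stageLevel.to_comp.comp
            (Computable.succ.comp (Computable.fst.comp Computable.fst)) Computable.snd)))
    -- The bounded quantifier is decided by counting: it holds exactly when the count reaches its
    -- bound.
    have h2 := computable_count (R := fun (z : ℕ × ℕ) x =>
      q z.2 x ≤ 2 * p z.2 x * 2 ^ stageLevel (z.1 + 1) x) h1
    have h3 : Computable fun z : ℕ × ℕ => z.1 + 1 := Computable.succ.comp Computable.fst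
    refine (computablePred_le h3 (h2.comp Computable.id h3)).of_eq fun z => ?_
    have h4 := Nat.count_le (p := fun x => q z.2 x ≤ 2 * p z.2 x * 2 ^ stageLevel (z.1 + 1) x)
      (n := z.1 + 1)
    rw [← Nat.count_iff_forall]
    constructor
    · intro h5
      refine le_antisymm ?_ ?_
      · convert! h4
      · convert! h5
    · intro h5
      refine le_of_eq ?_
      convert! h5.symm
  have hiff : ∀ u s x, q u x ≤ 2 * p u x * 2 ^ stageLevel s x ↔ stageCostFun s x ≤ 2 * cs u x := by
    intro u s x
    obtain ⟨h1, h2⟩ := hpq u x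
    rw [h2, stageCostFun, ← mul_div_assoc, div_le_div_iff₀ (by positivity) (by exact_mod_cast h1),
      one_mul]
    exact_mod_cast Iff.rfl
  have hex : ∀ s, ∃ᶠ u in atTop,
      ∀ x < s + 1, q u x ≤ 2 * p u x * 2 ^ stageLevel (s + 1) x := by
    intro s
    refine Eventually.frequently ?_
    have : ∀ᶠ u in atTop, ∀ x ∈ Finset.range (s + 1),
        q u x ≤ 2 * p u x * 2 ^ stageLevel (s + 1) x := by
      refine (eventually_all_finset _).2 fun x _ => ?_
      have h1 := stageCostFun_le_costFun (s + 1) x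
      have h2 : (0 : ℝ) < stageCostFun (s + 1) x := by exact_mod_cast stageCostFun_pos (s + 1) x
      filter_upwards [(hc.tendsto x).eventually
        (lt_mem_nhds (by linarith : (stageCostFun (s + 1) x : ℝ) / 2 < costFun x))] with u hu
      rw [hiff]
      have : (stageCostFun (s + 1) x : ℝ) ≤ 2 * cs u x := by linarith
      exact_mod_cast this
    simpa using this
  obtain ⟨f, hf, hmono, hfs⟩ := exists_computable_strictMono hR hex
  refine ⟨fun s => As (f s), hA.comp hf hmono, ?_⟩
  -- The increment `1 / 2 ^ (s + 1)` of `-1 / 2 ^ s` pays for changes at numbers above `s`, whose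
  -- levels are still the initial ones.
  have hstep : ∀ s, stageCost stageCostFun (fun s => As (f s)) s ≤
      (2 * costBefore cs As (f (s + 1)) - 1 / 2 ^ (s + 1)) -
        (2 * costBefore cs As (f s) - 1 / 2 ^ s) := by
    intro s
    have h1 := monotone_costBefore h0 As (hmono (Nat.lt_succ_self s)).le
    have h2 : (1 : ℚ) / 2 ^ s - 1 / 2 ^ (s + 1) = 1 / 2 ^ (s + 1) := by
      rw [pow_succ]; field_simp; norm_num
    have h3 : (0 : ℚ) < 1 / 2 ^ (s + 1) := by positivity
    unfold stageCost
    split_ifs with h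
    · by_cases hx : Nat.find h < s + 1
      · have h4 := (hiff _ _ _).1 (hfs s _ hx)
        have h5 := cost_le_of_change h0 hc.antitone hc.monotone (hmono (Nat.lt_succ_self s)).le
          le_rfl (Nat.find_spec h)
        linarith
      · have h4 : stageCostFun (s + 1) (Nat.find h) ≤ 1 / 2 ^ (s + 1) := by
          rw [stageCostFun, stageLevel_eq_self (by omega)]
          exact one_div_le_one_div_of_le (by positivity)
            (pow_le_pow_right₀ (by norm_num) (by omega))
        linarith
    · linarith
  refine summable_of_le_sub (C := 2 * ∑' s, (stageCost cs As s : ℝ))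
    (g := fun s => ((2 * costBefore cs As (f s) - 1 / 2 ^ s : ℚ) : ℝ)) (fun s => ?_) (fun s => ?_)
    fun s => ?_
  · exact_mod_cast stageCost_nonneg (fun s x => (stageCostFun_pos s x).le) _ s
  · have := (Rat.cast_le (K := ℝ)).2 (hstep s)
    rwa [Rat.cast_sub] at this
  · have h1 := costBefore_le_tsum h0 hsum (f s)
    have h2 : (0 : ℝ) < 1 / 2 ^ s := by positivity
    push_cast
    linarith

/-! ### Confirmed stages -/

theorem exists_change_of_changes_ne {Cs : ℕ → ℕ → Bool} {x k l : ℕ} (hkl : k ≤ l)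
    (h : changes Cs x k ≠ changes Cs x l) : ∃ m, k ≤ m ∧ m ≤ l ∧ Cs m x ≠ Cs k x := by
  by_contra! hc
  apply h
  induction l, hkl using Nat.le_induction with
  | base => rfl
  | succ l hl ih =>
    have h1 : changes Cs x (l + 1) = changes Cs x l := by
      simp only [changes, Nat.count_succ]
      simp [hc l hl (by omega), hc (l + 1) (by omega) le_rfl]
    rw [h1]
    refine ih (fun h' => h ?_) fun m h2 h3 => hc m h2 (by omega)
    rw [h1, h']

/-- The `k`-th stage at which the stream with index `i` is confirmed. -/
noncomputable def confirmStage (i k : ℕ) : ℕ :=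
  Nat.nth (fun s => Confirms s ∧ s.unpair.1 = i) k

/-- The set stage which is confirmed for the `k`-th time. -/
noncomputable def confirmedAt (i k : ℕ) : ℕ := inspected (confirmStage i k) i

theorem computablePred_confirms (i : ℕ) :
    ComputablePred fun s => Confirms s ∧ s.unpair.1 = i :=
  (primrecPred_confirms.and (Primrec.eq.comp (Primrec.fst.comp Primrec.unpair)
    (Primrec.const i))).computablePred

section SetIndex

variable {i : ℕ} {As : ℕ → ℕ → Bool} (hi : IsSetIndex i As)

include hi

theorem IsSetIndex.infinite_confirms : {s | Confirms s ∧ s.unpair.1 = i}.Infinite :=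
  Set.infinite_of_forall_exists_gt fun N =>
    let ⟨s, hs, h⟩ := hi.exists_confirms (N + 1)
    ⟨s, h, hs⟩

theorem IsSetIndex.confirms_confirmStage (k : ℕ) :
    Confirms (confirmStage i k) ∧ (confirmStage i k).unpair.1 = i :=
  Nat.nth_mem_of_infinite hi.infinite_confirms k

theorem IsSetIndex.strictMono_confirmStage : StrictMono (confirmStage i) :=
  Nat.nth_strictMono hi.infinite_confirms

theorem IsSetIndex.strictMono_confirmedAt : StrictMono (confirmedAt i) := fun k l hkl => by
  have h := hi.confirms_confirmStage k
  exact (inspected_le _ _).trans_lt (lt_inspected h.1.1 h.2 (hi.strictMono_confirmStage hkl))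

theorem IsSetIndex.computable_confirmedAt : Computable (confirmedAt i) :=
  primrec_inspected.to_comp.comp (computable_nth (computablePred_confirms i)
    hi.infinite_confirms) (Computable.const i)

end SetIndex

/-! ### Obedience of the change set -/

section Requirement

variable {r : ℕ} {As Bs : ℕ → ℕ → Bool} {p q : ℕ → ℕ → ℕ}
  (hi : IsSetIndex r.unpair.1 As) (he : IsCostIndex r.unpair.2.unpair.1 Bs p q)
  {A : Set ℕ} (hA : IsComputableApprox As A) (hB : IsComputableApprox Bs A)

/-- The stage at which requirement `r` finds its `j`-th target, counting from `0`. -/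
noncomputable def advanceStage (r j : ℕ) : ℕ := Nat.nth (fun s => Advances s r) j

/-- The `j`-th target of requirement `r`. -/
noncomputable def targetAt (r j : ℕ) : ℕ := (stageTarget (advanceStage r j + 1) r).2

open Classical in
/-- The number of confirmations of the set stream of `r` before its `j`-th target is found. -/
noncomputable def confirmCount (r j : ℕ) : ℕ :=
  Nat.count (fun s => Confirms s ∧ s.unpair.1 = r.unpair.1) (advanceStage r j)

open Classical in
theorem stageTarget_fst_eq_count (s : ℕ) :
    (stageTarget s r).1 = Nat.count (fun s => Advances s r) s := by
  induction s with
  | zero => simp [stageTarget_zero]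
  | succ s ih =>
    rw [Nat.count_succ, ← ih]
    split_ifs with h
    · rw [stageTarget_succ_of_advances h]
    · rw [stageTarget_succ_of_not h, add_zero]

theorem computablePred_advances (r : ℕ) : ComputablePred fun s => Advances s r :=
  (primrecRel_advances.comp Primrec.id (Primrec.const r)).computablePred

include hi he hA hB

theorem infinite_advances : {s | Advances s r}.Infinite :=
  Set.infinite_of_forall_exists_gt fun N =>
    let ⟨s, hs, h⟩ := exists_advances hi he hA hB (N + 1)
    ⟨s, h, hs⟩

theorem advances_advanceStage (j : ℕ) : Advances (advanceStage r j) r :=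
  Nat.nth_mem_of_infinite (infinite_advances hi he hA hB) j

theorem strictMono_advanceStage : StrictMono (advanceStage r) :=
  Nat.nth_strictMono (infinite_advances hi he hA hB)

theorem stageTarget_fst_advanceStage (j : ℕ) :
    (stageTarget (advanceStage r j + 1) r).1 = j + 1 := by
  classical
  rw [stageTarget_fst_eq_count, advanceStage]
  exact Nat.count_nth_succ_of_infinite (infinite_advances hi he hA hB) j

theorem stageTarget_eq_of_between {j z : ℕ} (h1 : advanceStage r j < z)
    (h2 : z ≤ advanceStage r (j + 1)) :
    stageTarget z r = stageTarget (advanceStage r j + 1) r := by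
  classical
  induction z, (show advanceStage r j + 1 ≤ z from h1) using Nat.le_induction with
  | base => rfl
  | succ z hz ih =>
    rw [stageTarget_succ_of_not, ih hz (by omega)]
    intro hadv
    have h3 : advanceStage r (Nat.count (fun s => Advances s r) z) = z := Nat.nth_count hadv
    have h4 := strictMono_advanceStage hi he hA hB
    rw [← h3] at hz h2
    have h5 := h4.lt_iff_lt.1 (show advanceStage r j < advanceStage r _ from hz)
    have h6 := h4.lt_iff_lt.1 (show advanceStage r _ < advanceStage r (j + 1) from h2)
    omega

theorem strictMono_targetAt : StrictMono (targetAt r) := strictMono_nat_of_lt_succ fun j => by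
  have h := (advances_advanceStage hi he hA hB (j + 1)).lt
  rwa [stageTarget_eq_of_between hi he hA hB
    (strictMono_advanceStage hi he hA hB (Nat.lt_succ_self j)) le_rfl] at h

theorem confirmStage_confirmCount (j : ℕ) :
    confirmStage r.unpair.1 (confirmCount r j) = advanceStage r j := by
  classical
  have h := (advances_advanceStage hi he hA hB j).1
  exact Nat.nth_count (p := fun s => Confirms s ∧ s.unpair.1 = r.unpair.1) ⟨h.1, h.2.1⟩

theorem strictMono_confirmCount : StrictMono (confirmCount r) := fun j k hjk => by
  rw [← hi.strictMono_confirmStage.lt_iff_lt, confirmStage_confirmCount hi he hA hB,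
    confirmStage_confirmCount hi he hA hB]
  exact strictMono_advanceStage hi he hA hB hjk

theorem computable_advanceStage : Computable (advanceStage r) :=
  computable_nth (computablePred_advances r) (infinite_advances hi he hA hB)

theorem computable_targetAt : Computable (targetAt r) :=
  Computable.snd.comp (primrec_stageTarget.to_comp.comp
    (Computable.succ.comp (computable_advanceStage hi he hA hB)) (Computable.const r))

theorem computable_confirmCount : Computable (confirmCount r) :=
  ((computable_count (R := fun (_ : ℕ) s => Confirms s ∧ s.unpair.1 = r.unpair.1)
    (computablePred_comp (computablePred_confirms r.unpair.1) Computable.snd)).comp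
      (Computable.const 0) (computable_advanceStage hi he hA hB)).of_eq
        fun j => by unfold confirmCount; congr!

variable {ds : ℕ → ℕ → ℚ} {d : ℕ → ℝ} (hpq : ∀ v x, 0 < q v x ∧ ds v x = (p v x : ℚ) / q v x)
  (hd : IsMonotoneApprox ds d)

include hpq hd in
/-- A change of the confirmed values between two targets is paid for, either by a change of `As`
or by a change of `Bs`. -/
theorem cost_le_of_confirmed_change (hcard : ∀ s m, (lowerings s r m).card <
    r.unpair.2.unpair.2 * 2 ^ m) {D : ℚ} (hD1 : 1 ≤ D) (hD : ∀ v x, ds v x ≤ D) {j x : ℕ}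
    (hx : x ≤ j) {k : ℕ} (hk : confirmCount r j ≤ k) (hk' : k ≤ confirmCount r (j + 1))
    (hne : As (confirmedAt r.unpair.1 k) x ≠ As (confirmedAt r.unpair.1 (confirmCount r j)) x) :
    ds (targetAt r j) x ≤ D * 2 ^ r *
      (costBefore stageCostFun As (inspected (advanceStage r (j + 1)) r.unpair.1) -
        costBefore stageCostFun As (inspected (advanceStage r j) r.unpair.1)) +
      (costBefore ds Bs (targetAt r (j + 1)) - costBefore ds Bs (targetAt r j)) := by
  classical
  have h0 : ∀ s x, 0 ≤ stageCostFun s x := fun s x => (stageCostFun_pos s x).le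
  have hd0 := hd.computable.nonneg
  -- With `y` least, the confirmed value still agrees with the target below `y`, as `confirms_spec`
  -- demands.
  have hex : ∃ y, ∃ k, confirmCount r j ≤ k ∧ k ≤ confirmCount r (j + 1) ∧
      As (confirmedAt r.unpair.1 k) y ≠ As (confirmedAt r.unpair.1 (confirmCount r j)) y :=
    ⟨x, k, hk, hk', hne⟩
  have hyx : Nat.find hex ≤ x := Nat.find_min' hex ⟨k, hk, hk', hne⟩
  clear hk hk' hne
  obtain ⟨k, hk, hk', hne⟩ := Nat.find_spec hex
  have hmin : ∀ y < Nat.find hex, ∀ k, confirmCount r j ≤ k → k ≤ confirmCount r (j + 1) →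
      As (confirmedAt r.unpair.1 k) y =
        As (confirmedAt r.unpair.1 (confirmCount r j)) y := by
    intro y hy k h1 h2
    by_contra h3
    exact Nat.find_min hex hy ⟨k, h1, h2, h3⟩
  generalize Nat.find hex = y at hne hmin hyx
  have e1 : ∀ j, confirmedAt r.unpair.1 (confirmCount r j) =
      inspected (advanceStage r j) r.unpair.1 := fun j => by
    rw [confirmedAt, confirmStage_confirmCount hi he hA hB]
  have hmono := hi.strictMono_confirmStage
  have hz1 : advanceStage r j < confirmStage r.unpair.1 k := by
    rw [← confirmStage_confirmCount hi he hA hB j, hmono.lt_iff_lt]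
    refine lt_of_le_of_ne hk fun h => hne (by rw [h])
  have hz2 : confirmStage r.unpair.1 k ≤ advanceStage r (j + 1) := by
    rw [← confirmStage_confirmCount hi he hA hB (j + 1)]
    exact hmono.monotone hk'
  have htz := stageTarget_eq_of_between hi he hA hB hz1 hz2
  have hfst := stageTarget_fst_advanceStage hi he hA hB
  have hagree : ∀ j, ∀ y < j + 1, As (inspected (advanceStage r j) r.unpair.1) y =
      Bs (targetAt r j) y := fun j y hy =>
    advances_spec hi he (advances_advanceStage hi he hA hB j) y (by rwa [hfst])
  rw [e1] at hne hmin
  have hconf := hi.confirms_confirmStage k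
  have hspec := confirms_spec (x := y) hi he hconf.1 hconf.2
    (by rw [htz, hfst]; omega)
    (fun y' hy' => by
      rw [htz]
      exact (hmin y' hy' k hk hk').trans (hagree j y' (by omega)))
    (by
      rw [htz]
      exact fun h => hne (h.trans (hagree j y (by omega)).symm)) (hcard _)
  rw [htz] at hspec
  -- If the level of `y` is at most `r`, its cost is at least `2 ^ (-r)` and the factor `D * 2 ^ r`
  -- absorbs any `ds`; otherwise its cost already dominates `ds`.
  have hpay : ds (targetAt r j) y ≤ D * 2 ^ r * stageCostFun (confirmedAt r.unpair.1 k) y := by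
    have h2r : (1 : ℚ) ≤ 2 ^ r := one_le_pow₀ (by norm_num)
    rcases hspec with h | h
    · have h1 : (1 : ℚ) / 2 ^ r ≤ stageCostFun (confirmedAt r.unpair.1 k) y :=
        one_div_le_one_div_of_le (by positivity) (pow_le_pow_right₀ (by norm_num) h)
      have h2 : (1 : ℚ) ≤ 2 ^ r * stageCostFun (confirmedAt r.unpair.1 k) y := by
        rw [div_le_iff₀ (by positivity)] at h1
        linarith
      calc ds (targetAt r j) y ≤ D := hD _ _
        _ ≤ D * (2 ^ r * stageCostFun (confirmedAt r.unpair.1 k) y) :=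
          le_mul_of_one_le_right (by linarith) h2
        _ = _ := by ring
    · have h1 : ds (targetAt r j) y ≤ stageCostFun (confirmedAt r.unpair.1 k) y := by
        obtain ⟨hq, hdq⟩ := hpq (targetAt r j) y
        rw [hdq, stageCostFun, div_le_div_iff₀ (by exact_mod_cast hq) (by positivity), one_mul]
        exact_mod_cast h
      refine h1.trans (le_mul_of_one_le_left (h0 _ _) ?_)
      exact one_le_mul_of_one_le_of_one_le hD1 h2r
  have hxy := hd.antitone (targetAt r j) hyx
  have u1 : inspected (advanceStage r j) r.unpair.1 ≤ confirmedAt r.unpair.1 k :=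
    monotone_inspected _ hz1.le
  have u2 : confirmedAt r.unpair.1 k ≤ inspected (advanceStage r (j + 1)) r.unpair.1 :=
    monotone_inspected _ hz2
  have v1 := (strictMono_targetAt hi he hA hB (Nat.lt_succ_self j)).le
  have c1 := monotone_costBefore h0 As u1
  have c2 := monotone_costBefore h0 As u2
  have c3 := monotone_costBefore hd0 Bs v1
  have hM : (0 : ℚ) ≤ D * 2 ^ r := by positivity
  -- At the next target `As` and `Bs` agree at `y` again. If `As` has kept the confirmed value, `Bs`
  -- had to change at `y`; otherwise `As` pays.
  by_cases hret : As (confirmedAt r.unpair.1 k) y =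
      As (inspected (advanceStage r (j + 1)) r.unpair.1) y
  · have h1 : Bs (targetAt r j) y ≠ Bs (targetAt r (j + 1)) y := by
      rw [← hagree j y (by omega), ← hagree (j + 1) y (by omega), ← hret]
      exact hne.symm
    have h2 := cost_le_of_change hd0 hd.antitone hd.monotone v1 le_rfl h1
    have h3 := mul_nonneg hM (sub_nonneg.2 (c1.trans c2))
    linarith
  · have h1 := cost_le_of_change h0 antitone_stageCostFun monotone_stageCostFun u2 le_rfl hret
    have h2 : D * 2 ^ r * stageCostFun (confirmedAt r.unpair.1 k) y ≤ D * 2 ^ r *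
      (costBefore stageCostFun As (inspected (advanceStage r (j + 1)) r.unpair.1) -
        costBefore stageCostFun As (inspected (advanceStage r j) r.unpair.1)) :=
      mul_le_mul_of_nonneg_left (by linarith) hM
    linarith

end Requirement

/-- The change set is enumerated at the pace of the targets of a requirement `r` chosen for `d`. Its
costs then telescope against the payments of `As` and `Bs` between consecutive targets. -/
theorem obeys_changeSet {i : ℕ} {As : ℕ → ℕ → Bool} (hi : IsSetIndex i As) {A : Set ℕ}
    (hA : IsComputableApprox As A) (hcA : Summable fun s => (stageCost stageCostFun As s : ℝ))
    {d : ℕ → ℝ} (hdc : IsCostFunction d) (h : Obeys A d) :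
    Obeys (changeSet fun k => As (confirmedAt i k)) d := by
  classical
  obtain ⟨Bs, ds, hB, hd, hcB⟩ := h
  obtain ⟨p, q, hp, hq, hpq⟩ := hd.computable
  have h0 : ∀ s x, 0 ≤ stageCostFun s x := fun s x => (stageCostFun_pos s x).le
  have hd0 := hd.computable.nonneg
  obtain ⟨e, he⟩ := exists_index (computable_map_range
    (f := fun v x => (Bs v x, p v x, q v x)) (hB.computable.pair (hp.pair hq)))
  obtain ⟨K, hK⟩ := exists_nat_gt
    (1 + 2 * (∑' s, (stageCost stageCostFun As s : ℝ) + ∑' s, (stageCost ds Bs s : ℝ)))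
  obtain ⟨r, hr1, hr2, hr3⟩ : ∃ r : ℕ, r.unpair.1 = i ∧ r.unpair.2.unpair.1 = e ∧
      r.unpair.2.unpair.2 = K := ⟨Nat.pair i (Nat.pair e K), by simp, by simp, by simp⟩
  subst hr1 hr2 hr3
  have hcard := card_lowerings_lt hi he hpq hd hcA hcB hK
  obtain ⟨D, hD⟩ := exists_nat_ge (d 0)
  have hDs : ∀ v x, ds v x ≤ (D + 1 : ℚ) := fun v x => by
    have h1 : (ds v x : ℝ) ≤ d x := Monotone.ge_of_tendsto (f := fun s => (ds s x : ℝ))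
      (fun _ _ h => Rat.cast_le.2 (hd.monotone x h)) (hd.tendsto x) v
    have h2 : (ds v x : ℝ) ≤ D + 1 := by linarith [hdc.antitone (Nat.zero_le x)]
    exact_mod_cast h2
  have hv := strictMono_targetAt hi he hA hB
  have hF := strictMono_confirmCount hi he hA hB
  have hBA := hA.comp hi.computable_confirmedAt hi.strictMono_confirmedAt
  let Cs : ℕ → ℕ → Bool := fun k => As (confirmedAt r.unpair.1 k)
  let Ws : ℕ → ℕ → Bool := fun j w =>
    decide (w.unpair.2 ≤ changes Cs w.unpair.1 (confirmCount r j))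
  -- The step from `j` to `j + 1` is charged by `ds' (j + 1)`, hence the shift to the `j`-th target.
  -- The cutoff makes changes above `j` free, so only codes `w ≤ j` need the bound on confirmed
  -- changes.
  let ds' : ℕ → ℕ → ℚ := fun j x => if x < j then ds (targetAt r (j - 1)) x else 0
  refine ⟨Ws, ds', ⟨?_, fun w => ?_⟩,
    ⟨?_, fun j x y hxy => ?_, fun x j k hjk => ?_, fun x => ?_⟩, ?_⟩
  · have h1 : ComputablePred fun z : ℕ × ℕ =>
        z.2.unpair.2 ≤ changes Cs z.2.unpair.1 (confirmCount r z.1) :=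
      computablePred_le (Computable.snd.comp (Computable.unpair.comp Computable.snd))
        ((computable_changes hBA.computable).comp
          (Computable.fst.comp (Computable.unpair.comp Computable.snd))
          ((computable_confirmCount hi he hA hB).comp Computable.fst))
    exact h1.decide
  · simp only [Ws, decide_eq_true_eq, mem_changeSet]
    by_cases hw : ∃ F, w.unpair.2 ≤ changes Cs w.unpair.1 F
    · obtain ⟨F, hF'⟩ := hw
      filter_upwards [hF.tendsto_atTop.eventually_ge_atTop F] with j hj
      exact iff_of_true (hF'.trans (monotone_changes _ _ hj)) ⟨F, hF'⟩
    · exact Eventually.of_forall fun j => iff_of_false (fun h => hw ⟨_, h⟩) hw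
  · have hv' : Computable fun z : ℕ × ℕ => targetAt r (z.1 - 1) :=
      (computable_targetAt hi he hA hB).comp (Computable.pred.comp Computable.fst)
    refine ⟨fun j x => if x < j then p (targetAt r (j - 1)) x else 0,
      fun j x => q (targetAt r (j - 1)) x, ?_, hq.comp hv' Computable.snd, fun j x =>
        ⟨(hpq _ _).1, ?_⟩⟩
    · refine (computable_ite (p := fun z : ℕ × ℕ => z.2 < z.1)
        (computablePred_le (Computable.succ.comp Computable.snd) Computable.fst)
        (hp.comp hv' Computable.snd) (Computable.const 0)).of_eq fun z => ?_
      congr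
    · simp only [ds']
      split_ifs
      · exact (hpq _ _).2
      · simp
  · simp only [ds']
    split_ifs with h1 h2 h2
    · exact hd.antitone _ hxy
    · omega
    · exact hd0 _ _
    · exact le_rfl
  · simp only [ds']
    split_ifs with h1 h2 h2
    · exact hd.monotone x (hv.monotone (by omega))
    · omega
    · exact hd0 _ _
    · exact le_rfl
  · have h1 : Tendsto (fun j => targetAt r (j - 1)) atTop atTop :=
      hv.tendsto_atTop.comp (tendsto_sub_atTop_nat 1)
    refine ((hd.tendsto x).comp h1).congr' ?_
    filter_upwards [eventually_gt_atTop x] with j hj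
    simp [ds', hj]
  · have hstep : ∀ j, stageCost ds' Ws j ≤
        ((D + 1) * 2 ^ r *
          costBefore stageCostFun As (inspected (advanceStage r (j + 1)) r.unpair.1) +
          costBefore ds Bs (targetAt r (j + 1))) -
        ((D + 1) * 2 ^ r *
          costBefore stageCostFun As (inspected (advanceStage r j) r.unpair.1) +
          costBefore ds Bs (targetAt r j)) := by
      intro j
      have c1 := monotone_costBefore h0 As (monotone_inspected r.unpair.1
        (strictMono_advanceStage hi he hA hB (Nat.lt_succ_self j)).le)
      have c2 := monotone_costBefore hd0 Bs (hv (Nat.lt_succ_self j)).le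
      have hM : (0 : ℚ) ≤ (D + 1) * 2 ^ r := by positivity
      have c3 := mul_le_mul_of_nonneg_left c1 hM
      have hpos : (0 : ℚ) ≤ _ := sub_nonneg.2 (add_le_add c3 c2)
      unfold stageCost
      split_ifs with hex
      · by_cases hw : Nat.find hex < j + 1
        · have hne := Nat.find_spec hex
          generalize Nat.find hex = w at hw hne ⊢
          have hch : changes Cs w.unpair.1 (confirmCount r j) ≠
              changes Cs w.unpair.1 (confirmCount r (j + 1)) := fun h => hne (by
            simp only [Ws, h])
          obtain ⟨k, hk, hk', hkne⟩ := exists_change_of_changes_ne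
            (hF (Nat.lt_succ_self j)).le hch
          have hwx : w.unpair.1 ≤ w := Nat.unpair_left_le w
          have h1 := cost_le_of_confirmed_change hi he hA hB hpq hd hcard
            (by linarith [(Nat.cast_nonneg D : (0 : ℚ) ≤ D)] : (1 : ℚ) ≤ D + 1) hDs
            (show w.unpair.1 ≤ j by omega) hk hk' hkne
          have h2 := hd.antitone (targetAt r j) hwx
          simp only [ds', hw, if_true, Nat.add_sub_cancel]
          linarith
        · simp only [ds', hw, if_false]
          exact hpos
      · exact hpos
    refine summable_of_le_sub (C := (D + 1) * 2 ^ r * (∑' s, (stageCost stageCostFun As s : ℝ)) +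
      ∑' s, (stageCost ds Bs s : ℝ)) (g := fun j => (((D + 1) * 2 ^ r *
          costBefore stageCostFun As (inspected (advanceStage r j) r.unpair.1) +
          costBefore ds Bs (targetAt r j) : ℚ) : ℝ)) (fun j => ?_) (fun j => ?_) fun j => ?_
    · have hds' : ∀ j x, 0 ≤ ds' j x := fun j x => by
        simp only [ds']
        split_ifs
        · exact hd0 _ _
        · exact le_rfl
      exact_mod_cast stageCost_nonneg hds' Ws j
    · have := (Rat.cast_le (K := ℝ)).2 (hstep j)
      rwa [Rat.cast_sub] at this
    · have h1 := costBefore_le_tsum h0 hcA (inspected (advanceStage r j) r.unpair.1)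
      have h2 := costBefore_le_tsum hd0 hcB (targetAt r j)
      push_cast
      gcongr

end CostFunction

/-! ### Assembly of the theorem -/

theorem theorem1p3 :
    ∃ c : ℕ → ℝ, CostFunction.IsBenign c ∧
      ∀ A : Set ℕ, CostFunction.IsDelta02 A → CostFunction.Obeys A c →
        ∃ W : Set ℕ, CostFunction.IsCE W ∧ CostFunction.Computes W A ∧
          (∃ (As : ℕ → ℕ → Bool) (f : ℕ → ℕ),
            CostFunction.IsComputableApprox As A ∧ StrictMono f ∧ Computable f ∧
            W = CostFunction.changeSet (fun s => As (f s))) ∧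
          ∀ d : ℕ → ℝ, CostFunction.IsCostFunction d →
            CostFunction.Obeys A d → CostFunction.Obeys W d := by
  refine ⟨CostFunction.costFun, CostFunction.isBenign_costFun, fun A _ hA => ?_⟩
  obtain ⟨As, hAs, hcost⟩ := CostFunction.exists_speedup hA
  obtain ⟨i, hi⟩ := CostFunction.exists_index
    (CostFunction.computable_map_range hAs.computable)
  have hi : CostFunction.IsSetIndex i As := hi
  have hB := hAs.comp hi.computable_confirmedAt hi.strictMono_confirmedAt
  exact ⟨_, CostFunction.isCE_changeSet hB.computable, CostFunction.computes_changeSet hB,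
    ⟨As, _, hAs, hi.strictMono_confirmedAt, hi.computable_confirmedAt, rfl⟩,
    fun d hd h => CostFunction.obeys_changeSet hi hAs hcost hd h⟩
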